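/- **Lemma 3.1 (Cylindrical Ends).** Let $Y$ be a closed (compact, boundaryless, Hausdorff) smooth manifold with a smooth Riemannian metric $h$, and let $M=Y\times(1,\infty)_r$ carry the product metric $g_0=dr^2+h$, with Riemannian distance $d$ (equal to $\infty$ between different components) and open balls $B(x,\omega)$. Let $C_b^\infty(M)$ be the set of smooth functions $f$ on $M$ with $\sup_M|\nabla^j f|_{g_0}<\infty$ for every $j\ge 0$, where $\nabla^j f$ is the $j$-th Levi-Civita covariant derivative of $f$. Let $a:M\to\mathbb{R}$ be a function (the damping) satisfying the Network Control Condition $(L,\omega,2\beta,S)$ on $M$, that is: $L,\omega,2\beta>0$, $S\subset M$, $d(x,S)\le L$ for every $x\in M$, and $a\ge 2\beta$ on $\bigcup_{y\in S}B(y,\omega)$. Put $\Omega_{2\beta}=\{x\in M: a(x)>2\beta\}$. Then there are a single real-valued function $\psi\in C_b^\infty(M)$ with $1\le\psi\le 3$ and a constant $\rho>0$ such that $|\nabla_{g_0}\psi(x)|\ge 2\rho$ at every $x\in M$ with $a(x)<2\beta$; and, if moreover $\bigcup_{y\in S}B(y,\omega)\subset\Omega_{2\beta}$, then $$x\notin\Omega_{2\beta}\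 \Longrightarrow\ |\nabla_{g_0}\psi(x)|\ge 2\rho .$$ -/

import Mathlib

/-- The Christoffel symbols of the Levi-Civita connection of a metric `g` given in coordinates, at
the point `x`: `Γ(u, v)` is the vector with
`g(Γ(u, v), w) = ½ (∂ᵤ g(v, w) + ∂ᵥ g(u, w) - ∂_w g(u, v))` for all `w`. -/
noncomputable def christoffel {E : Type*} [NormedAddCommGroup E] [NormedSpace ℝ E]
    (g : E → E →L[ℝ] E →L[ℝ] ℝ) (x u v : E) : E :=
  let Dg : E →L[ℝ] E →L[ℝ] E →L[ℝ] ℝ := fderiv ℝ g x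
  (1 / 2 : ℝ) • (g x).inverse (Dg u v + Dg v u - (Dg.flip u).flip v)

/-- The form `((v, s), (v', s')) ↦ b(v, v') + s s'` on `F × ℝ`. -/
noncomputable def addSqForm {F : Type*} [NormedAddCommGroup F] [NormedSpace ℝ F]
    (b : F →L[ℝ] F →L[ℝ] ℝ) : (F × ℝ) →L[ℝ] (F × ℝ) →L[ℝ] ℝ :=
  b.bilinearComp (.fst ℝ F ℝ) (.fst ℝ F ℝ) +
    (ContinuousLinearMap.mul ℝ ℝ).bilinearComp (.snd ℝ F ℝ) (.snd ℝ F ℝ)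

theorem addSqForm_apply {F : Type*} [NormedAddCommGroup F] [NormedSpace ℝ F]
    (b : F →L[ℝ] F →L[ℝ] ℝ) (v w : F × ℝ) :
    addSqForm b v w = b v.1 w.1 + v.2 * w.2 := rfl

theorem addSqForm_symm {F : Type*} [NormedAddCommGroup F] [NormedSpace ℝ F]
    (b : F →L[ℝ] F →L[ℝ] ℝ) (hb : ∀ v w, b v w = b w v) (v w : F × ℝ) :
    addSqForm b v w = addSqForm b w v := by
  rw [addSqForm_apply, addSqForm_apply, hb, mul_comm]

theorem addSqForm_pos {F : Type*} [NormedAddCommGroup F] [NormedSpace ℝ F]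
    (b : F →L[ℝ] F →L[ℝ] ℝ) (hb : ∀ v, v ≠ 0 → 0 < b v v) (v : F × ℝ) (hv : v ≠ 0) :
    0 < addSqForm b v v := by
  rw [addSqForm_apply]
  by_cases h1 : v.1 = 0
  · have h2 : v.2 ≠ 0 := fun h2 => hv (Prod.ext h1 h2)
    rw [h1, map_zero, zero_add]
    exact mul_self_pos.2 h2
  · exact add_pos_of_pos_of_nonneg (hb v.1 h1) (mul_self_nonneg _)

theorem addSqForm_continuous {F : Type*} [NormedAddCommGroup F] [NormedSpace ℝ F]
    (b : F →L[ℝ] F →L[ℝ] ℝ) : Continuous fun v : F × ℝ => addSqForm b v v := by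
  simp only [addSqForm_apply]
  fun_prop

theorem addSqForm_isVonNBounded {F : Type*} [NormedAddCommGroup F] [NormedSpace ℝ F]
    (b : F →L[ℝ] F →L[ℝ] ℝ) (hb : ∀ v, v ≠ 0 → 0 < b v v)
    (h1 : Bornology.IsVonNBounded ℝ {v : F | b v v < 1}) :
    Bornology.IsVonNBounded ℝ {v : F × ℝ | addSqForm b v v < 1} := by
  have h2 : Bornology.IsVonNBounded ℝ (Metric.ball (0 : ℝ) 1) :=
    NormedSpace.isVonNBounded_ball ℝ ℝ 1
  rw [NormedSpace.isVonNBounded_iff] at h1 h2 ⊢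
  refine (h1.prod h2).subset ?_
  intro v hv
  rw [Set.mem_ofPred_eq, addSqForm_apply] at hv
  have h0 : 0 ≤ b v.1 v.1 := by
    by_cases hz : v.1 = 0
    · rw [hz, map_zero]
    · exact (hb v.1 hz).le
  refine ⟨?_, ?_⟩
  · rw [Set.mem_ofPred_eq]
    nlinarith [mul_self_nonneg v.2]
  · rw [mem_ball_zero_iff, Real.norm_eq_abs, ← sq_lt_one_iff_abs_lt_one]
    nlinarith

open Bundle Manifold
open scoped ContDiff ENNReal Topology

noncomputable section

/-! ### Riemannian manifolds (boundaryless, finite-dimensional): gradient, `C_b^∞`, network control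

The Riemannian metric is Mathlib's `RiemannianBundle` structure on the tangent bundle, the distance
is Mathlib's `riemannianEDist` (infimum of lengths of `C¹` paths, `⊤` between distinct components). -/

section Riemannian

variable {E : Type*} [NormedAddCommGroup E] [NormedSpace ℝ E]
  {H : Type*} [TopologicalSpace H] (I : ModelWithCorners ℝ E H)
  {M : Type*} [TopologicalSpace M] [ChartedSpace H M] [IsManifold I ∞ M]
  [RiemannianBundle (fun x : M => TangentSpace I x)]

/-- The Riemannian gradient: the tangent vector `∇f(x)` with `⟪∇f(x), X⟫ = df(x) X` for all `X`. -/
def riemGradient [FiniteDimensional ℝ E] (f : M → ℝ) (x : M) : TangentSpace I x :=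
  haveI : FiniteDimensional ℝ (TangentSpace I x) := inferInstanceAs (FiniteDimensional ℝ E)
  haveI : CompleteSpace (TangentSpace I x) := FiniteDimensional.complete ℝ _
  (InnerProductSpace.toDual ℝ (TangentSpace I x)).symm (mfderiv I 𝓘(ℝ, ℝ) f x)

set_option synthInstance.maxHeartbeats 400000 in
/-- The coordinate expression `x ↦ (g_{ij}(x))` of the metric in the chart of `M` around `c`, as a
bilinear form on the model space. -/
def metricInChart (c : M) (x : E) : E →L[ℝ] E →L[ℝ] ℝ :=
  let q : M := (extChartAt I c).symm x
  let A : E →L[ℝ] TangentSpace I q := mfderiv 𝓘(ℝ, E) I (extChartAt I c).symm x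
  (innerSL ℝ (E := TangentSpace I q)).bilinearComp A A

/-- The coordinate expression, in the chart around `c`, of the iterated Levi-Civita covariant
derivative `∇ʲf`, a covariant `j`-tensor: `∇⁰f = f` and
`(∇ʲ⁺¹f)(v₀, v₁, …, v_j) = ∂_{v₀} ((∇ʲf)(v₁, …, v_j)) - ∑ᵢ (∇ʲf)(v₁, …, Γ(v₀, vᵢ), …, v_j)`. -/
def iteratedCovDeriv (f : M → ℝ) (c : M) : (j : ℕ) → E → (Fin j → E) → ℝ
  | 0 => fun x _ => f ((extChartAt I c).symm x)
  | j + 1 => fun x v =>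
      fderiv ℝ (fun y => iteratedCovDeriv f c j y (Fin.tail v)) x (v 0)
        - ∑ i : Fin j, iteratedCovDeriv f c j x
            (Function.update (Fin.tail v) i (christoffel (metricInChart I c) x (v 0) (Fin.tail v i)))

/-- `f ∈ C_b^∞(M)`: `f` is smooth and, for each `j`, the tensor norm of the covariant derivative
`∇ʲf` is bounded uniformly on `M`. At each point `p` the tensor `∇ʲf(p)` may be computed in any
chart containing `p`: its norm does not depend on the chart. -/
def IsCbInfty (f : M → ℝ) : Prop :=
  ContMDiff I 𝓘(ℝ, ℝ) ∞ f ∧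
    ∀ j : ℕ, ∃ C : ℝ, ∀ p : M, ∃ c : M, p ∈ (chartAt H c).source ∧
      ∀ v : Fin j → E,
        |iteratedCovDeriv I f c j (extChartAt I c p) v| ≤
          C * ∏ i, √(metricInChart I c (extChartAt I c p) (v i) (v i))

/-- The open ball `B(y, w)` for the Riemannian distance. -/
def riemBall (y : M) (w : ℝ) : Set M := {x | riemannianEDist I y x < ENNReal.ofReal w}

/-- The function `a` satisfies the network control condition with constants `L, w, κ > 0` and set of
points `S`: every point is at distance at most `L` from `S`, and `a ≥ κ` on the union of the balls
of radius `w` centred at the points of `S`. -/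
structure NetworkControl (a : M → ℝ) (L w κ : ℝ) (S : Set M) : Prop where
  L_pos : 0 < L
  w_pos : 0 < w
  kappa_pos : 0 < κ
  dist_le : ∀ x : M, (⨅ y ∈ S, riemannianEDist I x y) ≤ ENNReal.ofReal L
  le_on_balls : ∀ x ∈ (⋃ y ∈ S, riemBall I y w), κ ≤ a x

end Riemannian

/-- The region `Ω_υ = {a > υ}`. -/
def superlevel {M : Type*} (a : M → ℝ) (υ : ℝ) : Set M := {x | υ < a x}

/-! ### The cylindrical end `Y × (1, ∞)` with the metric `dr² + h` -/

/-- The half-line `(1, ∞)` as an open submanifold of `ℝ`. -/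
def rayOne : TopologicalSpace.Opens ℝ := ⟨Set.Ioi 1, isOpen_Ioi⟩

section Cylinder

variable {n : ℕ} {Y : Type*} [TopologicalSpace Y] [ChartedSpace (EuclideanSpace ℝ (Fin n)) Y]
  [IsManifold (𝓡 n) ∞ Y]

/-- The cylindrical end over the Riemannian manifold `(Y, h)`: as a manifold, it is the product
`Y × (1, ∞)`. The metric `h` is recorded in the type to determine the product metric. -/
def CylindricalEnd
    (_h : ContMDiffRiemannianMetric (𝓡 n) ∞ (EuclideanSpace ℝ (Fin n))
      (fun y : Y => TangentSpace (𝓡 n) y)) : Type _ :=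
  Y × rayOne

variable (h : ContMDiffRiemannianMetric (𝓡 n) ∞ (EuclideanSpace ℝ (Fin n))
      (fun y : Y => TangentSpace (𝓡 n) y))

instance : TopologicalSpace (CylindricalEnd h) := inferInstanceAs (TopologicalSpace (Y × rayOne))

instance : ChartedSpace (ModelProd (EuclideanSpace ℝ (Fin n)) ℝ) (CylindricalEnd h) :=
  inferInstanceAs (ChartedSpace (ModelProd (EuclideanSpace ℝ (Fin n)) ℝ) (Y × rayOne))

instance : IsManifold ((𝓡 n).prod 𝓘(ℝ, ℝ)) ∞ (CylindricalEnd h) :=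
  inferInstanceAs (IsManifold ((𝓡 n).prod 𝓘(ℝ, ℝ)) ∞ (Y × rayOne))

/-- The product Riemannian metric `g₀ = dr² + h` on the cylindrical end, with
`T_{(y, r)}(Y × (1, ∞)) = T_y Y × ℝ`. -/
def cylinderMetric :
    RiemannianMetric (fun p : CylindricalEnd h => TangentSpace ((𝓡 n).prod 𝓘(ℝ, ℝ)) p) where
  inner p := addSqForm (F := EuclideanSpace ℝ (Fin n)) (h.inner p.1)
  symm p := addSqForm_symm (F := EuclideanSpace ℝ (Fin n)) _ (h.symm p.1)
  pos p := addSqForm_pos (F := EuclideanSpace ℝ (Fin n)) _ (h.pos p.1)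
  continuousAt _ := (addSqForm_continuous (F := EuclideanSpace ℝ (Fin n)) _).continuousAt
  isVonNBounded p :=
    addSqForm_isVonNBounded (F := EuclideanSpace ℝ (Fin n)) _ (h.pos p.1) (h.isVonNBounded p.1)

instance :
    RiemannianBundle (fun p : CylindricalEnd h => TangentSpace ((𝓡 n).prod 𝓘(ℝ, ℝ)) p) :=
  ⟨cylinderMetric h⟩

end Cylinder

end

open Set Function Metric in
/-- There are smooth injective immersions, equal to the identity off a ball, for which the preimage
of a concentric smaller ball is contained in an arbitrarily small ball. -/
theorem exists_expanding_map {E : Type*} [NormedAddCommGroup E] [NormedSpace ℝ E]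
    [FiniteDimensional ℝ E] (z : E) {δ ε : ℝ} (hδ : 0 < δ) (hε : 0 < ε) :
    ∃ θ : E → E, ContDiff ℝ ∞ θ ∧ Injective θ ∧ (∀ x, Injective (fderiv ℝ θ x)) ∧
      (∀ x, x ∉ ball z (3 * δ) → θ x = x) ∧ ∀ x, θ x ∈ ball z (2 * δ) → x ∈ ball z ε := by
  let χ : ContDiffBump z := ⟨2 * δ, 3 * δ, by linarith, by linarith⟩
  let v : E → E := fun x => χ x • (x - z)
  have hv : ContDiff ℝ ∞ v := χ.contDiff.smul (contDiff_id.sub contDiff_const)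
  have hvc : HasCompactSupport v := χ.hasCompactSupport.smul_right
  obtain ⟨K, hK⟩ := hv.lipschitzWith_of_hasCompactSupport hvc (by simp)
  obtain ⟨η, hη, hηK⟩ : ∃ η : ℝ, 0 < η ∧ η * K < 1 := by
    refine ⟨1 / (K + 1), by positivity, ?_⟩
    rw [div_mul_eq_mul_div, one_mul, div_lt_one (by positivity)]
    linarith
  let θ : E → E := fun x => x + η • v x
  have hθ : ContDiff ℝ ∞ θ := contDiff_id.add (hv.const_smul η)
  have hθi : Injective θ := by
    intro x y hxy
    by_contra hne
    have h1 : x - y = η • (v y - v x) := by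
      have : x + η • v x = y + η • v y := hxy
      rw [smul_sub, sub_eq_sub_iff_add_eq_add, this, add_comm]
    have h2 : ‖v y - v x‖ ≤ K * ‖y - x‖ := by
      simpa [dist_eq_norm] using hK.dist_le_mul y x
    have h3 : 0 < ‖x - y‖ := norm_pos_iff.2 (sub_ne_zero.2 hne)
    have h4 : ‖x - y‖ ≤ η * (K * ‖x - y‖) := by
      calc ‖x - y‖ = η * ‖v y - v x‖ := by
            rw [h1, norm_smul, Real.norm_of_nonneg hη.le]
        _ ≤ η * (K * ‖y - x‖) := by gcongr
        _ = _ := by rw [norm_sub_rev]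
    nlinarith
  have hθd : ∀ x, Injective (fderiv ℝ θ x) := by
    intro x
    rw [injective_iff_map_eq_zero]
    intro u hu
    have hd : fderiv ℝ θ x = ContinuousLinearMap.id ℝ E + η • fderiv ℝ v x := by
      have hvx : DifferentiableAt ℝ v x := hv.differentiable (by simp) x
      exact ((hasFDerivAt_id x).add (hvx.hasFDerivAt.const_smul η)).fderiv
    rw [hd] at hu
    have h1 : u = -(η • fderiv ℝ v x u) := by
      simpa using eq_neg_of_add_eq_zero_left hu
    by_contra hne
    have h3 : 0 < ‖u‖ := norm_pos_iff.2 hne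
    have h4 : ‖u‖ ≤ η * (K * ‖u‖) := by
      calc ‖u‖ = η * ‖fderiv ℝ v x u‖ := by
            conv_lhs => rw [h1]
            rw [norm_neg, norm_smul, Real.norm_of_nonneg hη.le]
        _ ≤ η * (K * ‖u‖) := by
            gcongr
            exact (ContinuousLinearMap.le_opNorm _ _).trans
              (by gcongr; exact norm_fderiv_le_of_lipschitz ℝ hK)
    nlinarith
  have hθo : ∀ x, x ∉ ball z (3 * δ) → θ x = x := by
    intro x hx
    have : χ x = 0 := by
      rw [← notMem_support, χ.support_eq]
      exact hx
    simp [θ, v, this]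
  have hθe : ∀ s, s ≤ 2 * δ → ∀ x, θ x ∈ ball z s → x ∈ ball z ((1 + η)⁻¹ * s) := by
    intro s hs x hx
    have h1 : ‖θ x - z‖ = (1 + η * χ x) * ‖x - z‖ := by
      have : θ x - z = (1 + η * χ x) • (x - z) := by
        simp only [θ, v]
        module
      rw [this, norm_smul, Real.norm_of_nonneg]
      have := χ.nonneg (x := x)
      positivity
    rw [mem_ball_iff_norm, h1] at hx
    have h0 := χ.nonneg (x := x)
    have hz := norm_nonneg (x - z)
    have hxs : ‖x - z‖ < s := lt_of_le_of_lt (by nlinarith [mul_nonneg hη.le h0]) hx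
    have h2 : χ x = 1 := χ.one_of_mem_closedBall (by
      rw [mem_closedBall_iff_norm]; exact (hxs.trans_le hs).le)
    rw [h2, mul_one] at hx
    rw [mem_ball_iff_norm, ← div_eq_inv_mul, lt_div_iff₀ (by positivity)]
    linarith
  have hq : (1 + η)⁻¹ < 1 := inv_lt_one_of_one_lt₀ (by linarith)
  have hq0 : 0 < (1 + η)⁻¹ := by positivity
  obtain ⟨k, hk⟩ := exists_pow_lt_of_lt_one (show 0 < ε / (2 * δ) by positivity) hq
  refine ⟨θ^[k], ?_, hθi.iterate k, ?_, ?_, ?_⟩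
  · clear hk
    induction k with
    | zero => exact contDiff_id
    | succ k ih => rw [iterate_succ']; exact hθ.comp ih
  · have hs : ∀ j, ContDiff ℝ ∞ θ^[j] := by
      intro j
      induction j with
      | zero => exact contDiff_id
      | succ k ih => rw [iterate_succ']; exact hθ.comp ih
    clear hk
    induction k with
    | zero =>
      intro x
      rw [iterate_zero, fderiv_id]
      exact injective_id
    | succ k ih =>
      intro x
      rw [iterate_succ', fderiv_comp x (hθ.differentiable (by simp) _)
        ((hs k).differentiable (by simp) _)]
      exact (hθd _).comp (ih x)
  · intro x hx
    exact iterate_fixed (hθo x hx) k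
  · have : ∀ j x, θ^[j] x ∈ ball z (2 * δ) → x ∈ ball z ((1 + η)⁻¹ ^ j * (2 * δ)) := by
      intro j
      induction j with
      | zero => intro x hx; simpa using hx
      | succ j ih =>
        intro x hx
        rw [iterate_succ_apply] at hx
        have := hθe _ ?_ x (ih _ hx)
        · rwa [← mul_assoc, ← pow_succ'] at this
        · have : (1 + η)⁻¹ ^ j ≤ 1 := pow_le_one₀ hq0.le hq.le
          nlinarith
    intro x hx
    refine ball_subset_ball ?_ (this k x hx)
    rw [lt_div_iff₀ (by positivity)] at hk
    exact hk.le

section Moving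

variable {E : Type*} [NormedAddCommGroup E] [NormedSpace ℝ E]
  {H : Type*} [TopologicalSpace H] (I : ModelWithCorners ℝ E H)
  {X : Type*} [TopologicalSpace X] [ChartedSpace H X]

/-- Smooth injective immersions of a manifold into itself. -/
structure IsInjImmersion (Ψ : X → X) : Prop where
  contMDiff : ContMDiff I I ∞ Ψ
  injective : Function.Injective Ψ
  injective_mfderiv : ∀ x, Function.Injective (mfderiv I I Ψ x)

variable {I}

theorem IsInjImmersion.id : IsInjImmersion I (id : X → X) :=
  ⟨contMDiff_id, Function.injective_id, fun x => by
    rw [mfderiv_id]; exact Function.injective_id⟩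

theorem IsInjImmersion.comp {Ψ₁ Ψ₂ : X → X} (h₁ : IsInjImmersion I Ψ₁)
    (h₂ : IsInjImmersion I Ψ₂) : IsInjImmersion I (Ψ₁ ∘ Ψ₂) :=
  ⟨h₁.contMDiff.comp h₂.contMDiff, h₁.injective.comp h₂.injective, fun x => by
    rw [mfderiv_comp x (h₁.contMDiff.mdifferentiable (by simp) _)
      (h₂.contMDiff.mdifferentiable (by simp) _)]
    exact (h₁.injective_mfderiv _).comp (h₂.injective_mfderiv x)⟩

/-- An injective map that is the identity off `W` maps `W` into itself. -/
theorem Function.Injective.mapsTo_of_eq_off {α : Type*} {f : α → α} (hf : Function.Injective f)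
    {W : Set α} (h : ∀ x ∉ W, f x = x) {x : α} (hx : x ∈ W) : f x ∈ W := by
  by_contra hn
  have := hf (h _ hn)
  rw [this] at hn
  exact hn hx

variable [FiniteDimensional ℝ E] [T2Space X] [I.Boundaryless] [IsManifold I ∞ X]

open Set Function Metric in
/-- Small open sets can be compressed into arbitrarily small neighbourhoods of any of their points:
preimages under injective immersions supported nearby. -/
theorem exists_injImmersion_of_chart (x : X) {W : Set X} (hW : W ∈ 𝓝 x) :
    ∃ B, IsOpen B ∧ x ∈ B ∧ B ⊆ W ∧ ∀ z ∈ B, ∀ U ∈ 𝓝 z, ∃ Ψ : X → X, IsInjImmersion I Ψ ∧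
      (∀ y ∉ W, Ψ y = y) ∧ ∀ y, Ψ y ∈ B → y ∈ U := by
  set φ := extChartAt I x with hφ
  have ht : φ.target ∩ φ.symm ⁻¹' W ∈ 𝓝 (φ x) := by
    refine Filter.inter_mem (extChartAt_target_mem_nhds x) ?_
    apply (continuousAt_extChartAt_symm x).preimage_mem_nhds
    rwa [extChartAt_to_inv]
  obtain ⟨r, hr, hball⟩ := Metric.nhds_basis_closedBall.mem_iff.1 ht
  set δ := r / 5 with hδ'
  have hδ : 0 < δ := by positivity
  have hopen : IsOpen (φ.source ∩ φ ⁻¹' ball (φ x) δ) :=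
    isOpen_extChartAt_preimage' x isOpen_ball
  refine ⟨φ.source ∩ φ ⁻¹' ball (φ x) δ, hopen, ⟨mem_extChartAt_source x, by simpa using hδ⟩,
    ?_, ?_⟩
  · rintro y ⟨hy, hyb⟩
    have h1 : φ y ∈ closedBall (φ x) r :=
      (ball_subset_closedBall.trans (closedBall_subset_closedBall (by linarith))) hyb
    have := (hball h1).2
    rwa [mem_preimage, φ.left_inv hy] at this
  rintro z ⟨hz, hzb⟩ U hU
  have hU' : φ.symm ⁻¹' U ∈ 𝓝 (φ z) := by
    apply (continuousAt_extChartAt_symm' hz).preimage_mem_nhds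
    rwa [φ.left_inv hz]
  obtain ⟨ε, hε, hεU⟩ := Metric.nhds_basis_ball.mem_iff.1 hU'
  obtain ⟨θ, hθ, hθi, hθd, hθo, hθe⟩ := exists_expanding_map (φ z) hδ hε
  have hzx : dist (φ z) (φ x) < δ := hzb
  have hsub : closedBall (φ z) (3 * δ) ⊆ closedBall (φ x) r :=
    closedBall_subset_closedBall' (by linarith)
  have htarget : closedBall (φ z) (3 * δ) ⊆ φ.target := fun y hy => (hball (hsub hy)).1
  set C : Set X := φ.symm '' closedBall (φ z) (3 * δ) with hC
  have hCc : IsClosed C :=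
    ((isCompact_closedBall _ _).image_of_continuousOn
      ((continuousOn_extChartAt_symm x).mono htarget)).isClosed
  have hCs : C ⊆ φ.source := by
    rintro _ ⟨y, hy, rfl⟩
    exact φ.map_target (htarget hy)
  have hCW : C ⊆ W := by
    rintro _ ⟨y, hy, rfl⟩
    exact (hball (hsub hy)).2
  have hθt : ∀ y ∈ φ.target, θ y ∈ φ.target := by
    intro y hy
    by_cases hyb : y ∈ ball (φ z) (3 * δ)
    · exact htarget (ball_subset_closedBall (hθi.mapsTo_of_eq_off hθo hyb))
    · rwa [hθo y hyb]
  classical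
  let Ψ : X → X := fun y => if y ∈ φ.source then φ.symm (θ (φ y)) else y
  have hΨs : ∀ y ∈ φ.source, Ψ y = φ.symm (θ (φ y)) := fun y hy => if_pos hy
  have hΨn : ∀ y ∉ φ.source, Ψ y = y := fun y hy => if_neg hy
  have hΨC : ∀ y ∉ C, Ψ y = y := by
    intro y hy
    by_cases hys : y ∈ φ.source
    · rw [hΨs y hys, hθo, φ.left_inv hys]
      intro hb
      exact hy ⟨φ y, ball_subset_closedBall hb, φ.left_inv hys⟩
    · exact hΨn y hys
  have hΨss : ∀ y ∈ φ.source, Ψ y ∈ φ.source := fun y hy => by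
    rw [hΨs y hy]
    exact φ.map_target (hθt _ (φ.map_source hy))
  have hev : ∀ y ∈ φ.source, Ψ =ᶠ[𝓝 y] φ.symm ∘ θ ∘ φ := fun y hy => by
    filter_upwards [(isOpen_extChartAt_source x).mem_nhds hy] with y' hy'
    exact hΨs y' hy'
  have hev' : ∀ y ∉ C, Ψ =ᶠ[𝓝 y] id := fun y hy => by
    filter_upwards [hCc.isOpen_compl.mem_nhds hy] with y' hy'
    exact hΨC y' hy'
  have hsm1 : ∀ y ∈ φ.source, ContMDiffAt I 𝓘(ℝ, E) ∞ φ y := fun y hy =>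
    contMDiffAt_extChartAt' (by rwa [← extChartAt_source I])
  have hsm2 : ∀ y ∈ φ.target, ContMDiffAt 𝓘(ℝ, E) I ∞ φ.symm y := fun y hy =>
    (contMDiffOn_extChartAt_symm x).contMDiffAt ((isOpen_extChartAt_target x).mem_nhds hy)
  refine ⟨Ψ, ⟨?_, ?_, ?_⟩, fun y hy => hΨC y fun h => hy (hCW h), ?_⟩
  · intro y
    by_cases hy : y ∈ φ.source
    · refine ContMDiffAt.congr_of_eventuallyEq ?_ (hev y hy)
      exact (hsm2 _ (hθt _ (φ.map_source hy))).comp y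
        (hθ.contMDiff.contMDiffAt.comp y (hsm1 y hy))
    · exact contMDiffAt_id.congr_of_eventuallyEq (hev' y fun h => hy (hCs h))
  · intro y y' hyy
    by_cases hy : y ∈ φ.source <;> by_cases hy' : y' ∈ φ.source
    · rw [hΨs y hy, hΨs y' hy'] at hyy
      exact φ.injOn hy hy' (hθi (φ.symm.injOn (hθt _ (φ.map_source hy))
        (hθt _ (φ.map_source hy')) hyy))
    · have := hΨss y hy
      rw [hyy, hΨn y' hy'] at this
      exact absurd this hy'
    · have := hΨss y' hy'
      rw [← hyy, hΨn y hy] at this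
      exact absurd this hy
    · rwa [hΨn y hy, hΨn y' hy'] at hyy
  · intro y
    by_cases hy : y ∈ φ.source
    · have hφy := φ.map_source hy
      have d1 := (hsm1 y hy).mdifferentiableAt (by simp)
      have d2 : MDifferentiableAt 𝓘(ℝ, E) 𝓘(ℝ, E) θ (φ y) :=
        hθ.contMDiff.contMDiffAt.mdifferentiableAt (by simp)
      have d3 := (hsm2 _ (hθt _ hφy)).mdifferentiableAt (by simp)
      rw [(hev y hy).mfderiv_eq, mfderiv_comp y (I' := 𝓘(ℝ, E)) d3 (d2.comp y d1),
        mfderiv_comp y (I' := 𝓘(ℝ, E)) d2 d1, mfderiv_eq_fderiv]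
      have i1 : Injective (mfderiv I 𝓘(ℝ, E) φ y) :=
        (isInvertible_mfderiv_extChartAt hy).injective
      have i3 : Injective (mfderiv 𝓘(ℝ, E) I φ.symm (θ (φ y))) := by
        have := (isInvertible_mfderivWithin_extChartAt_symm (I := I) (hθt _ hφy)).injective
        rwa [I.range_eq_univ, mfderivWithin_univ] at this
      exact i3.comp ((hθd _).comp i1)
    · rw [(hev' y fun h => hy (hCs h)).mfderiv_eq, mfderiv_id]
      exact injective_id
  · intro y hy
    by_cases hys : y ∈ φ.source
    · have h1 : θ (φ y) ∈ ball (φ x) δ := by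
        have := hy.2
        rwa [hΨs y hys, mem_preimage, φ.right_inv (hθt _ (φ.map_source hys))] at this
      have h2 : θ (φ y) ∈ ball (φ z) (2 * δ) := by
        refine ball_subset_ball' ?_ h1
        rw [dist_comm]
        linarith
      have := hεU (hθe _ h2)
      rwa [mem_preimage, φ.left_inv hys] at this
    · have := hy.1
      rw [hΨn y hys] at this
      exact absurd this hys

open Set Function in
/-- A point can be moved within its connected component. -/
theorem exists_injImmersion_of_isPreconnected [LocallyConnectedSpace X] {N U : Set X}
    (hN : IsOpen N) (hNc : IsPreconnected N) (hU : IsOpen U) (hNU : (N ∩ U).Nonempty) {p : X}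
    (hp : p ∈ N) :
    ∃ V, IsOpen V ∧ p ∈ V ∧ ∃ Ψ : X → X, IsInjImmersion I Ψ ∧ (∀ y ∉ N, Ψ y = y) ∧
      ∀ y, Ψ y ∈ V → y ∈ U := by
  let Q : X → Prop := fun q => ∃ V, IsOpen V ∧ q ∈ V ∧ ∃ Ψ : X → X, IsInjImmersion I Ψ ∧
    (∀ y ∉ N, Ψ y = y) ∧ ∀ y, Ψ y ∈ V → y ∈ U
  have hsub : N ⊆ {q | Q q} := by
    apply hNc.subset_of_closure_inter_subset
    · rw [isOpen_iff_mem_nhds]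
      rintro q ⟨V, hV, hqV, h⟩
      filter_upwards [hV.mem_nhds hqV] with q' hq'
      exact ⟨V, hV, hq', h⟩
    · obtain ⟨q, hqN, hqU⟩ := hNU
      exact ⟨q, hqN, U, hU, hqU, id, .id, fun _ _ => rfl, fun _ h => h⟩
    · rintro q ⟨hqc, hqN⟩
      obtain ⟨B, hB, hqB, -, hmove⟩ := exists_injImmersion_of_chart (I := I) q (hN.mem_nhds hqN)
      obtain ⟨z, hzB, V, hV, hzV, Ψ₂, h₂, h₂N, h₂U⟩ := mem_closure_iff.1 hqc B hB hqB
      obtain ⟨Ψ₁, h₁, h₁N, h₁V⟩ := hmove z hzB V (hV.mem_nhds hzV)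
      refine ⟨B, hB, hqB, Ψ₁ ∘ Ψ₂, h₁.comp h₂, fun y hy => ?_, fun y hy => h₂U y (h₁V _ hy)⟩
      rw [comp_apply, h₂N y hy, h₁N y hy]
  exact hsub hp

open Set Function in
theorem connectedComponentIn_diff_singleton_meets {X : Type*} [TopologicalSpace X] [T1Space X]
    [LocallyConnectedSpace X] {N V : Set X} (hN : IsOpen N) {p q : X} (hV : IsOpen V) (hpV : p ∈ V)
    (hq : q ∈ connectedComponentIn N p) (hqp : q ≠ p) :
    (connectedComponentIn (N \ {p}) q ∩ V).Nonempty := by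
  by_contra hne
  rw [not_nonempty_iff_eq_empty] at hne
  have hpN : p ∈ N := by
    by_contra h
    rw [connectedComponentIn_eq_empty h] at hq
    exact hq
  have hqN : q ∈ N \ {p} := ⟨connectedComponentIn_subset _ _ hq, hqp⟩
  have hNp : IsOpen (N \ {p}) := hN.sdiff isClosed_singleton
  have hsub : connectedComponentIn N p ⊆ connectedComponentIn (N \ {p}) q := by
    apply isPreconnected_connectedComponentIn.subset_of_closure_inter_subset
      hNp.connectedComponentIn ⟨q, hq, mem_connectedComponentIn hqN⟩
    rintro z ⟨hzc, hzN⟩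
    have hzp : z ≠ p := by
      rintro rfl
      obtain ⟨y, hyV, hy⟩ := mem_closure_iff.1 hzc V hV hpV
      exact (hne ▸ (⟨hy, hyV⟩ : y ∈ connectedComponentIn (N \ {z}) q ∩ V) : y ∈ (∅ : Set X))
    have hzN' : z ∈ N \ {p} := ⟨connectedComponentIn_subset _ _ hzN, hzp⟩
    obtain ⟨y, hyz, hyq⟩ := mem_closure_iff.1 hzc _ hNp.connectedComponentIn
      (mem_connectedComponentIn hzN')
    rw [connectedComponentIn_eq hyq, ← connectedComponentIn_eq hyz]
    exact mem_connectedComponentIn hzN'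
  exact (connectedComponentIn_subset _ _ (hsub (mem_connectedComponentIn hpN))).2 rfl

open Set Function in
/-- A finite set `F` can be moved into an open set meeting the relevant connected components. -/
theorem exists_injImmersion_of_finite [LocallyConnectedSpace X] {F : Set X} (hF : F.Finite) :
    ∀ {N U : Set X}, IsOpen N → IsOpen U → F ⊆ N →
      (∀ p ∈ F, (connectedComponentIn N p ∩ U).Nonempty) →
      ∃ Ψ : X → X, IsInjImmersion I Ψ ∧ (∀ y ∉ N, Ψ y = y) ∧ ∀ y, Ψ y ∈ F → y ∈ U := by
  induction F, hF using Set.Finite.induction_on with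
  | empty =>
    intro N U _ _ _ _
    exact ⟨id, .id, fun _ _ => rfl, fun _ h => absurd h (notMem_empty _)⟩
  | @insert p F hpF _ ih =>
    intro N U hN hU hFN hmeet
    have hpN : p ∈ N := hFN (mem_insert _ _)
    set N₀ := connectedComponentIn N p with hN₀
    have hN₀o : IsOpen N₀ := hN.connectedComponentIn
    obtain ⟨V, hV, hpV, Ψ₂, h₂, h₂N, h₂U⟩ := exists_injImmersion_of_isPreconnected (I := I) hN₀o
      isPreconnected_connectedComponentIn hU (hmeet p (mem_insert _ _))
      (mem_connectedComponentIn hpN)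
    have hrest : IsOpen (N \ N₀) := by
      rw [isOpen_iff_mem_nhds]
      rintro q ⟨hqN, hq⟩
      filter_upwards [hN.connectedComponentIn.mem_nhds (mem_connectedComponentIn hqN)] with z hz
      refine ⟨connectedComponentIn_subset _ _ hz, fun hz0 => hq ?_⟩
      rw [hN₀, connectedComponentIn_eq hz0, ← connectedComponentIn_eq hz]
      exact mem_connectedComponentIn hqN
    obtain ⟨Ψ₁, h₁, h₁N, h₁U⟩ := ih (N := N \ {p}) (U := V ∪ (U ∩ (N \ N₀)))
      (hN.sdiff isClosed_singleton) (hV.union (hU.inter hrest))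
      (fun q hq => ⟨hFN (mem_insert_of_mem _ hq), fun h => hpF (h ▸ hq)⟩) (by
        intro q hq
        have hqN : q ∈ N := hFN (mem_insert_of_mem _ hq)
        have hqp : q ≠ p := fun h => hpF (h ▸ hq)
        by_cases hq0 : q ∈ N₀
        · exact (connectedComponentIn_diff_singleton_meets hN hV hpV hq0 hqp).mono
            (inter_subset_inter_right _ subset_union_left)
        · have hdisj : ∀ z ∈ connectedComponentIn N q, z ∉ N₀ := by
            intro z hz hz0
            apply hq0
            rw [hN₀, connectedComponentIn_eq hz0, ← connectedComponentIn_eq hz]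
            exact mem_connectedComponentIn hqN
          obtain ⟨z, hzq, hzU⟩ := hmeet q (mem_insert_of_mem _ hq)
          refine ⟨z, ?_, Or.inr ⟨hzU, connectedComponentIn_subset _ _ hzq, hdisj z hzq⟩⟩
          refine isPreconnected_connectedComponentIn.subset_connectedComponentIn
            (mem_connectedComponentIn hqN) (fun y hy => ?_) hzq
          refine ⟨connectedComponentIn_subset _ _ hy, ?_⟩
          rintro rfl
          exact hdisj y hy (mem_connectedComponentIn hpN))
    refine ⟨Ψ₁ ∘ Ψ₂, h₁.comp h₂, fun y hy => ?_, fun y hy => ?_⟩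
    · rw [comp_apply, h₂N y fun h => hy (connectedComponentIn_subset _ _ h),
        h₁N y fun h => hy h.1]
    · have key : Ψ₂ y ∈ V ∪ (U ∩ (N \ N₀)) := by
        rcases mem_insert_iff.1 hy with h | h
        · have hpp : Ψ₁ p = p := h₁N p fun h => h.2 rfl
          have : Ψ₂ y = p := h₁.injective (h.trans hpp.symm)
          rw [this]
          exact Or.inl hpV
        · exact h₁U _ h
      rcases key with h | ⟨hU', _, h0⟩
      · exact h₂U y h
      · by_cases hy0 : y ∈ N₀
        · exact absurd (h₂.injective.mapsTo_of_eq_off h₂N hy0) h0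
        · rwa [h₂N y hy0] at hU'

end Moving

open Set Function MeasureTheory in
/-- A consequence of Sard's theorem in equal dimensions: for almost every value `a`, the map `G` is
injective near each point `b ∈ O` of the fibre over `a`. -/
theorem ae_forall_injOn_nhds_of_contDiffAt {V : Type*} [NormedAddCommGroup V] [NormedSpace ℝ V]
    [FiniteDimensional ℝ V] [MeasurableSpace V] [BorelSpace V] (μ : Measure V)
    [μ.IsAddHaarMeasure] {G : V → V} {O : Set V} (hG : ∀ b ∈ O, ContDiffAt ℝ ∞ G b) :
    ∀ᵐ a ∂μ, ∀ b ∈ O, G b = a → ∃ B ∈ 𝓝 b, InjOn G B := by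
  have hnull : μ (G '' {b ∈ O | (fderiv ℝ G b).det = 0}) = 0 :=
    addHaar_image_eq_zero_of_det_fderivWithin_eq_zero μ (f' := fderiv ℝ G)
      (fun b hb => ((hG b hb.1).differentiableAt (by simp)).hasFDerivAt.hasFDerivWithinAt)
      (fun b hb => hb.2)
  filter_upwards [compl_mem_ae_iff.2 hnull] with a ha b hb hba
  have hdet : (fderiv ℝ G b).det ≠ 0 := fun h => ha ⟨b, ⟨hb, h⟩, hba⟩
  have hstrict : HasStrictFDerivAt G
      ((fderiv ℝ G b).toContinuousLinearEquivOfDetNeZero hdet : V →L[ℝ] V) b := by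
    have := (hG b hb).hasStrictFDerivAt (by simp)
    rwa [ContinuousLinearMap.coe_toContinuousLinearEquivOfDetNeZero]
  refine ⟨_, hstrict.eventually_left_inverse, fun x hx y hy hxy => ?_⟩
  rw [← show _ = x from hx, hxy]
  exact hy

section FiniteCritical

variable {E : Type*} [NormedAddCommGroup E] [NormedSpace ℝ E] [FiniteDimensional ℝ E]
  {H : Type*} [TopologicalSpace H] (I : ModelWithCorners ℝ E H) [I.Boundaryless]
  {Y : Type*} [TopologicalSpace Y] [ChartedSpace H Y] [IsManifold I ∞ Y] [T2Space Y]
  [CompactSpace Y]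

open Set Function MeasureTheory in
theorem exists_contMDiff_finite_critical :
    ∃ m : Y → ℝ, ContMDiff I 𝓘(ℝ, ℝ) ∞ m ∧ {y | mfderiv I 𝓘(ℝ, ℝ) m y = 0}.Finite := by
  classical
  obtain ⟨ι, f, -⟩ := SmoothBumpCovering.exists_isSubordinate I (s := (univ : Set Y))
    (U := fun _ => univ) isClosed_univ (fun _ _ => Filter.univ_mem)
  have : Fintype ι := f.fintype
  let φ : ∀ i, PartialEquiv Y E := fun i => extChartAt I (f.c i)
  let e : ι → Y → E := fun j y => f j y • φ j y
  have he : ∀ j, ContMDiff I 𝓘(ℝ, E) ∞ (e j) := fun j =>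
    (f j).contMDiff_smul contMDiffOn_extChartAt
  have hsymm : ∀ i, ∀ x ∈ (φ i).target, ContMDiffAt 𝓘(ℝ, E) I ∞ (φ i).symm x := fun i x hx =>
    (contMDiffOn_extChartAt_symm (f.c i)).contMDiffAt
      ((isOpen_extChartAt_target (f.c i)).mem_nhds hx)
  let g : ι → ι → E → E := fun i j x => e j ((φ i).symm x)
  have hg : ∀ i j, ∀ x ∈ (φ i).target, ContDiffAt ℝ ∞ (g i j) x := fun i j x hx =>
    ((he j).contMDiffAt.comp x (hsymm i x hx)).contDiffAt
  let J : E ≃L[ℝ] (E →L[ℝ] ℝ) := ContinuousLinearEquiv.ofFinrankEq (by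
    rw [← (LinearMap.toContinuousLinearMap : (E →ₗ[ℝ] ℝ) ≃ₗ[ℝ] (E →L[ℝ] ℝ)).finrank_eq]
    exact (Subspace.dual_finrank_eq).symm)
  let m : (ι → E) → Y → ℝ := fun a y => ∑ j, J (a j) (e j y)
  have hm : ∀ a, ContMDiff I 𝓘(ℝ, ℝ) ∞ (m a) := fun a =>
    contMDiff_finsetSum fun j _ => (J (a j)).contMDiff.comp (he j)
  let W : ι → Set E := fun i => interior {x ∈ (φ i).target | g i i x = x}
  have hWt : ∀ i, W i ⊆ (φ i).target := fun i x hx => (interior_subset hx).1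
  let G : ι → (ι → E) → ι → E := fun i b =>
    update b i (-J.symm (∑ j ∈ Finset.univ.erase i, (J (b j)).comp (fderiv ℝ (g i j) (b i))))
  have hG : ∀ i, ∀ b ∈ {b : ι → E | b i ∈ W i}, ContDiffAt ℝ ∞ (G i) b := by
    intro i b hb
    rw [contDiffAt_pi]
    intro k
    rcases eq_or_ne k i with rfl | hk
    · simp only [G, update_self]
      refine (J.symm.contDiff.contDiffAt.comp b (ContDiffAt.sum fun j _ => ?_)).neg
      refine ContDiffAt.clm_comp ?_ ?_
      · exact J.contDiff.contDiffAt.comp b (contDiff_apply ℝ E j).contDiffAt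
      · exact ((hg k j _ (hWt k hb)).fderiv_right (m := ∞) (by simp)).comp b
          (contDiff_apply ℝ E k).contDiffAt
    · simp only [G, update_of_ne hk]
      exact (contDiff_apply ℝ E k).contDiffAt
  have hcrit : ∀ a i y, y ∈ (φ i).source → φ i y ∈ W i → mfderiv I 𝓘(ℝ, ℝ) (m a) y = 0 →
      G i (update a i (φ i y)) = a := by
    intro a i y hy hyW hmy
    have hxt := hWt i hyW
    have h1 : fderiv ℝ (m a ∘ (φ i).symm) (φ i y) = 0 := by
      rw [← mfderiv_eq_fderiv, mfderiv_comp (φ i y) (I' := I)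
        ((hm a).mdifferentiable (by simp) _) ((hsymm i _ hxt).mdifferentiableAt (by simp)),
        (φ i).left_inv hy, hmy]
      exact ContinuousLinearMap.zero_comp _
    have h2 : HasFDerivAt (m a ∘ (φ i).symm)
        (∑ j, (J (a j)).comp (fderiv ℝ (g i j) (φ i y))) (φ i y) := by
      have : m a ∘ (φ i).symm = fun x => ∑ j, J (a j) (g i j x) := rfl
      rw [this]
      exact HasFDerivAt.fun_sum fun j _ => (J (a j)).hasFDerivAt.comp _
        ((hg i j _ hxt).differentiableAt (by simp)).hasFDerivAt
    have h3 : fderiv ℝ (g i i) (φ i y) = ContinuousLinearMap.id ℝ E := by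
      have : g i i =ᶠ[𝓝 (φ i y)] id := by
        filter_upwards [isOpen_interior.mem_nhds hyW] with x hx
        exact (interior_subset hx).2
      rw [this.fderiv_eq, fderiv_id]
    rw [h2.fderiv, ← Finset.add_sum_erase _ _ (Finset.mem_univ i), h3,
      ContinuousLinearMap.comp_id] at h1
    have h4 : ∑ j ∈ Finset.univ.erase i,
        (J (update a i (φ i y) j)).comp (fderiv ℝ (g i j) (φ i y)) = -J (a i) := by
      rw [← eq_neg_of_add_eq_zero_right h1]
      refine Finset.sum_congr rfl fun j hj => ?_
      rw [update_of_ne (Finset.ne_of_mem_erase hj)]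
    simp only [G, update_self, update_idem]
    rw [h4, map_neg, neg_neg, J.symm_apply_apply, update_eq_self]
  borelize (ι → E)
  obtain ⟨a, ha⟩ : ∃ a : ι → E, ∀ i, ∀ b ∈ {b : ι → E | b i ∈ W i}, G i b = a →
      ∃ B ∈ 𝓝 b, InjOn (G i) B :=
    (Filter.eventually_all.2 fun i =>
      ae_forall_injOn_nhds_of_contDiffAt (Measure.addHaar (G := ι → E)) (hG i)).exists
  refine ⟨m a, hm a, ?_⟩
  set K : Set Y := {y | mfderiv I 𝓘(ℝ, ℝ) (m a) y = 0} with hK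
  have hloc : ∀ y, ∃ t ∈ 𝓝 y, (K ∩ t).Finite := by
    intro y
    set i := f.ind y (mem_univ y) with hi
    have hys : y ∈ (φ i).source := f.mem_extChartAt_ind_source y (mem_univ y)
    have hyW : φ i y ∈ W i := by
      rw [mem_interior_iff_mem_nhds]
      have h1 : ∀ᶠ x in 𝓝 (φ i y), f i ((φ i).symm x) = 1 := by
        have hc : Filter.Tendsto (φ i).symm (𝓝 (φ i y)) (𝓝 y) := by
          have := continuousAt_extChartAt_symm' hys
          rwa [ContinuousAt, (extChartAt I (f.c i)).left_inv hys] at this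
        exact hc.eventually (f.eventuallyEq_one y (mem_univ y))
      filter_upwards [h1, (isOpen_extChartAt_target (f.c i)).mem_nhds ((φ i).map_source hys)]
        with x hx hxt
      refine ⟨hxt, ?_⟩
      simp only [g, e]
      rw [hx, one_smul, (φ i).right_inv hxt]
    have hcont : ContinuousAt (φ i) y := continuousAt_extChartAt' hys
    have hupd : ContinuousAt (fun y' => update a i (φ i y')) y :=
      continuousAt_const.update i hcont
    have hnear : ∀ᶠ y' in 𝓝 y, y' ∈ (φ i).source ∧ φ i y' ∈ W i :=
      Filter.Eventually.and ((isOpen_extChartAt_source (f.c i)).mem_nhds hys)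
        (hcont.preimage_mem_nhds (isOpen_interior.mem_nhds hyW))
    have hbO : update a i (φ i y) ∈ {b : ι → E | b i ∈ W i} := by
      rw [mem_ofPred_eq, update_self]; exact hyW
    by_cases hba : G i (update a i (φ i y)) = a
    · obtain ⟨B, hB, hinj⟩ := ha i _ hbO hba
      refine ⟨_, hnear.and (hupd.preimage_mem_nhds hB), (finite_singleton y).subset ?_⟩
      rintro y' ⟨hy', ⟨hs', hW'⟩, hB'⟩
      have h1 := hinj hB' (mem_of_mem_nhds hB) ((hcrit a i y' hs' hW' hy').trans hba.symm)
      have h2 := congrFun h1 i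
      simp only [update_self] at h2
      exact (φ i).injOn hs' hys h2
    · have hne : ∀ᶠ y' in 𝓝 y, G i (update a i (φ i y')) ≠ a :=
        (ContinuousAt.comp (f := fun y' => update a i (φ i y')) (hG i _ hbO).continuousAt
          hupd).eventually_ne hba
      refine ⟨_, hnear.and hne, ?_⟩
      convert finite_empty
      rw [eq_empty_iff_forall_notMem]
      rintro y' ⟨hy', ⟨hs', hW'⟩, hn'⟩
      exact hn' (hcrit a i y' hs' hW' hy')
  choose t ht hfin using hloc
  obtain ⟨s, hs⟩ := finite_cover_nhds ht
  refine (s.finite_toSet.biUnion fun y _ => hfin y).subset fun y hy => ?_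
  have := hs.symm ▸ mem_univ y
  simp only [mem_iUnion] at this ⊢
  obtain ⟨z, hz, hyz⟩ := this
  exact ⟨z, hz, hy, hyz⟩

end FiniteCritical

/-! ### Iterated covariant derivatives in coordinates -/

section Coordinates

set_option synthInstance.maxHeartbeats 400000
set_option maxSynthPendingDepth 3

variable {E : Type*} [NormedAddCommGroup E] [NormedSpace ℝ E]

/-- The iterated Levi-Civita covariant derivatives of a function on a normed space, with respect to a
metric `g` in coordinates. -/
noncomputable def covIter (g : E → E →L[ℝ] E →L[ℝ] ℝ) (f : E → ℝ) : (j : ℕ) → E → (Fin j → E) → ℝ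
  | 0 => fun x _ => f x
  | j + 1 => fun x v =>
      fderiv ℝ (fun y => covIter g f j y (Fin.tail v)) x (v 0)
        - ∑ i : Fin j, covIter g f j x
            (Function.update (Fin.tail v) i (christoffel g x (v 0) (Fin.tail v i)))

theorem iteratedCovDeriv_eq_covIter {H : Type*} [TopologicalSpace H] (I : ModelWithCorners ℝ E H)
    {M : Type*} [TopologicalSpace M] [ChartedSpace H M] [IsManifold I ∞ M]
    [RiemannianBundle (fun x : M => TangentSpace I x)] (f : M → ℝ) (c : M) (j : ℕ) :
    iteratedCovDeriv I f c j = covIter (metricInChart I c) (f ∘ (extChartAt I c).symm) j := by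
  induction j with
  | zero => rfl
  | succ j ih =>
    funext x v
    simp only [iteratedCovDeriv, covIter, ih]

theorem christoffel_smul (g : E → E →L[ℝ] E →L[ℝ] ℝ) (x u v : E) (a b : ℝ) :
    christoffel g x (a • u) (b • v) = (a * b) • christoffel g x u v := by
  simp only [christoffel]
  rw [smul_comm (a * b) (1 / 2 : ℝ)]
  congr 1
  refine Eq.trans (congrArg _ ?_) (map_smul (g x).inverse (a * b) _)
  refine ContinuousLinearMap.ext fun w => ?_
  simp
  ring

theorem covIter_smul (g : E → E →L[ℝ] E →L[ℝ] ℝ) (f : E → ℝ) (j : ℕ) (x : E) (c : Fin j → ℝ)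
    (v : Fin j → E) :
    covIter g f j x (fun i => c i • v i) = (∏ i, c i) * covIter g f j x v := by
  induction j generalizing x with
  | zero => simp [covIter]
  | succ j ih =>
    simp only [covIter]
    have htail : Fin.tail (fun i => c i • v i) = fun i => Fin.tail c i • Fin.tail v i := rfl
    have hprod : ∏ i, c i = c 0 * ∏ i, Fin.tail c i := Fin.prod_univ_succ c
    rw [htail, mul_sub, Finset.mul_sum]
    congr 1
    · simp_rw [ih, map_smul, ← smul_eq_mul (∏ i, Fin.tail c i)]
      rw [show (fun y => (∏ i, Fin.tail c i) • covIter g f j y (Fin.tail v)) =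
        (∏ i, Fin.tail c i) • fun y => covIter g f j y (Fin.tail v) from rfl,
        fderiv_const_smul_field, hprod]
      simp only [Pi.smul_apply, smul_apply, smul_eq_mul]
      ring
    · refine Finset.sum_congr rfl fun i _ => ?_
      have hupd : Function.update (fun i => Fin.tail c i • Fin.tail v i) i
            (christoffel g x (c 0 • v 0) (Fin.tail c i • Fin.tail v i)) =
          fun k => Function.update (Fin.tail c) i (c 0 * Fin.tail c i) k •
            Function.update (Fin.tail v) i (christoffel g x (v 0) (Fin.tail v i)) k := by
        funext k
        rcases eq_or_ne k i with rfl | hk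
        · simp only [Function.update_self, christoffel_smul]
        · simp only [Function.update_of_ne hk]
      rw [hupd, ih, Finset.prod_update_of_mem (Finset.mem_univ i), hprod,
        ← Finset.mul_prod_erase Finset.univ (Fin.tail c) (Finset.mem_univ i),
        Finset.sdiff_singleton_eq_erase]
      ring

theorem eventually_covIter_eq_translate {g g' : E → E →L[ℝ] E →L[ℝ] ℝ} {f f' : E → ℝ} {x τ : E}
    (hg : ∀ᶠ y in 𝓝 x, g' y = g (y + τ)) (hf : ∀ᶠ y in 𝓝 x, f' y = f (y + τ)) (j : ℕ) :
    ∀ᶠ y in 𝓝 x, ∀ v, covIter g' f' j y v = covIter g f j (y + τ) v := by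
  have hΓ : ∀ᶠ y in 𝓝 x, ∀ u v, christoffel g' y u v = christoffel g (y + τ) u v := by
    filter_upwards [hg.eventually_nhds] with y hy u v
    have h1 : g' y = g (y + τ) := hy.self_of_nhds
    have h2 : fderiv ℝ g' y = fderiv ℝ g (y + τ) := by
      rw [Filter.EventuallyEq.fderiv_eq (f := fun z => g (z + τ)) hy, fderiv_comp_add_right]
    simp only [christoffel, h1, h2]
  induction j with
  | zero =>
    filter_upwards [hf] with y hy v
    exact hy
  | succ j ih =>
    filter_upwards [ih.eventually_nhds, hΓ] with y hy hyΓ v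
    have h1 : fderiv ℝ (fun z => covIter g' f' j z (Fin.tail v)) y =
        fderiv ℝ (fun z => covIter g f j z (Fin.tail v)) (y + τ) := by
      rw [← fderiv_comp_add_right]
      exact Filter.EventuallyEq.fderiv_eq (hy.mono fun z hz => hz _)
    have h2 := hy.self_of_nhds
    simp only [covIter, h1, h2, hyΓ]

theorem ContDiffOn.clm_flip {P F₁ F₂ F₃ : Type*} [NormedAddCommGroup P] [NormedSpace ℝ P]
    [NormedAddCommGroup F₁] [NormedSpace ℝ F₁] [NormedAddCommGroup F₂] [NormedSpace ℝ F₂]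
    [NormedAddCommGroup F₃] [NormedSpace ℝ F₃] {A : P → F₁ →L[ℝ] F₂ →L[ℝ] F₃} {s : Set P}
    {n : WithTop ℕ∞} (hA : ContDiffOn ℝ n A s) : ContDiffOn ℝ n (fun p => (A p).flip) s :=
  (ContinuousLinearMap.flipₗᵢ ℝ F₁ F₂ F₃).contDiff.comp_contDiffOn hA

variable [FiniteDimensional ℝ E]

theorem contDiffOn_christoffel {g : E → E →L[ℝ] E →L[ℝ] ℝ} {O : Set E} (hO : IsOpen O)
    (hg : ContDiffOn ℝ ∞ g O) (hinv : ∀ x ∈ O, (g x).IsInvertible) {P : Type*}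
    [NormedAddCommGroup P] [NormedSpace ℝ P] {s : Set P} {x u v : P → E}
    (hx : ContDiffOn ℝ ∞ x s) (hu : ContDiffOn ℝ ∞ u s) (hv : ContDiffOn ℝ ∞ v s)
    (hxs : Set.MapsTo x s O) :
    ContDiffOn ℝ ∞ (fun p => christoffel g (x p) (u p) (v p)) s := by
  have hD : ContDiffOn ℝ ∞ (fun p => fderiv ℝ g (x p)) s :=
    (hg.fderiv_of_isOpen hO (by simp)).comp hx hxs
  have hI : ContDiffOn ℝ ∞ (fun p => (g (x p)).inverse) s := by
    intro p hp
    exact ((hinv _ (hxs hp)).contDiffAt_map_inverse).comp_contDiffWithinAt p ((hg.comp hx hxs) p hp)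
  simp only [christoffel]
  refine ContDiffOn.const_smul _ (hI.clm_apply ?_)
  exact (((hD.clm_apply hu).clm_apply hv).add ((hD.clm_apply hv).clm_apply hu)).sub
    ((hD.clm_flip.clm_apply hu).clm_flip.clm_apply hv)

theorem contDiffOn_covIter {g : E → E →L[ℝ] E →L[ℝ] ℝ} {f : E → ℝ} {O : Set E} (hO : IsOpen O)
    (hg : ContDiffOn ℝ ∞ g O) (hinv : ∀ x ∈ O, (g x).IsInvertible) (hf : ContDiffOn ℝ ∞ f O)
    (j : ℕ) : ContDiffOn ℝ ∞ (fun p : E × (Fin j → E) => covIter g f j p.1 p.2)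
      (O ×ˢ Set.univ) := by
  induction j with
  | zero => exact hf.comp contDiffOn_fst fun p hp => hp.1
  | succ j ih =>
    have happ : ∀ k, ContDiff ℝ ∞ fun p : E × (Fin (j + 1) → E) => p.2 k := fun k =>
      (contDiff_apply ℝ E k).comp contDiff_snd
    have htail : ContDiff ℝ ∞ fun p : E × (Fin (j + 1) → E) => Fin.tail p.2 :=
      contDiff_pi.2 fun k => happ k.succ
    simp only [covIter]
    refine ContDiffOn.sub ?_ (ContDiffOn.sum fun i _ => ?_)
    · have hopen : IsOpen (O ×ˢ (Set.univ : Set (Fin (j + 1) → E))) := hO.prod isOpen_univ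
      intro p hp
      refine ContDiffAt.contDiffWithinAt ?_
      refine ContDiffAt.clm_apply (ContDiffAt.fderiv (m := ∞) (n := ∞)
        (f := fun (p : E × (Fin (j + 1) → E)) y => covIter g f j y (Fin.tail p.2))
        (g := fun p => p.1) ?_ contDiffAt_fst (by simp)) (happ 0).contDiffAt
      have h1 : ContDiffAt ℝ ∞ (fun p : E × (Fin j → E) => covIter g f j p.1 p.2)
          (p.1, Fin.tail p.2) :=
        ih.contDiffAt ((hO.prod isOpen_univ).mem_nhds ⟨hp.1, Set.mem_univ _⟩)
      exact h1.comp (p, p.1) (f := fun q : (E × (Fin (j + 1) → E)) × E => (q.2, Fin.tail q.1.2))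
        (contDiffAt_snd.prodMk (htail.comp contDiff_fst).contDiffAt)
    · have hupd : ContDiffOn ℝ ∞ (fun p : E × (Fin (j + 1) → E) => Function.update (Fin.tail p.2) i
          (christoffel g p.1 (p.2 0) (Fin.tail p.2 i))) (O ×ˢ Set.univ) := by
        rw [contDiffOn_pi]
        intro k
        rcases eq_or_ne k i with rfl | hk
        · simp only [Function.update_self]
          exact contDiffOn_christoffel hO hg hinv contDiffOn_fst (happ 0).contDiffOn
            (happ _).contDiffOn fun p hp => hp.1
        · simp only [Function.update_of_ne hk]
          exact (happ k.succ).contDiffOn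
      exact ih.comp (contDiffOn_fst.prodMk hupd) fun p hp => ⟨hp.1, Set.mem_univ _⟩

theorem isInvertible_of_pos {b : E →L[ℝ] E →L[ℝ] ℝ} (hb : ∀ v, v ≠ 0 → 0 < b v v) :
    b.IsInvertible := by
  have hinj : Function.Injective b := by
    rw [injective_iff_map_eq_zero]
    intro v hv
    by_contra h
    have := hb v h
    rw [hv] at this
    exact lt_irrefl _ this
  have hfin : Module.finrank ℝ E = Module.finrank ℝ (E →L[ℝ] ℝ) := by
    rw [← (LinearMap.toContinuousLinearMap : (E →ₗ[ℝ] ℝ) ≃ₗ[ℝ] (E →L[ℝ] ℝ)).finrank_eq]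
    exact (Subspace.dual_finrank_eq).symm
  let e := (LinearEquiv.ofInjectiveOfFinrankEq b.toLinearMap hinj hfin).toContinuousLinearEquiv
  exact ⟨e, by ext v w; rfl⟩

/-- On a compact set, the given metric dominates the norm. -/
theorem exists_norm_le_mul_sqrt {g : E → E →L[ℝ] E →L[ℝ] ℝ} {K : Set E} (hK : IsCompact K)
    (hg : ContinuousOn g K) (hpos : ∀ x ∈ K, ∀ v, v ≠ 0 → 0 < g x v v) :
    ∃ C : ℝ, 0 ≤ C ∧ ∀ x ∈ K, ∀ v, ‖v‖ ≤ C * √(g x v v) := by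
  have hcont : ContinuousOn (fun p : E × E => (√(g p.1 p.2 p.2))⁻¹)
      (K ×ˢ Metric.sphere (0 : E) 1) := by
    refine ContinuousOn.inv₀ (Real.continuous_sqrt.comp_continuousOn ?_) ?_
    · have h1 : ContinuousOn (fun p : E × E => g p.1) (K ×ˢ Metric.sphere (0 : E) 1) :=
        hg.comp continuousOn_fst fun p hp => hp.1
      exact (h1.clm_apply continuousOn_snd).clm_apply continuousOn_snd
    · intro p hp
      refine (Real.sqrt_pos.2 (hpos _ hp.1 _ ?_)).ne'
      rintro h0
      have := hp.2
      rw [h0] at this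
      simp at this
  obtain ⟨C, hC⟩ := (hK.prod (isCompact_sphere (0 : E) 1)).exists_bound_of_continuousOn hcont
  refine ⟨max C 0, le_max_right _ _, fun x hx v => ?_⟩
  rcases eq_or_ne v 0 with rfl | hv
  · simp
  have hn : 0 < ‖v‖ := norm_pos_iff.2 hv
  have h1 := hC (x, ‖v‖⁻¹ • v) ⟨hx, by simp [norm_smul, hn.ne']⟩
  have h2 : g x (‖v‖⁻¹ • v) (‖v‖⁻¹ • v) = ‖v‖⁻¹ ^ 2 * g x v v := by
    simp only [map_smul, smul_apply, smul_eq_mul]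
    ring
  have hs : 0 < √(g x v v) := Real.sqrt_pos.2 (hpos x hx v hv)
  simp only [h2] at h1
  rw [Real.sqrt_mul (by positivity), Real.sqrt_sq (by positivity), Real.norm_of_nonneg
    (by positivity), mul_inv, inv_inv, mul_inv_le_iff₀ hs] at h1
  exact h1.trans (by gcongr; exact le_max_left _ _)

/-- Covariant derivatives are bounded on compact sets. -/
theorem exists_covIter_le {g : E → E →L[ℝ] E →L[ℝ] ℝ} {f : E → ℝ} {O K : Set E} (hO : IsOpen O)
    (hg : ContDiffOn ℝ ∞ g O) (hpos : ∀ x ∈ O, ∀ v, v ≠ 0 → 0 < g x v v)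
    (hf : ContDiffOn ℝ ∞ f O) (hK : IsCompact K) (hKO : K ⊆ O) (j : ℕ) :
    ∃ C : ℝ, 0 ≤ C ∧ ∀ x ∈ K, ∀ v : Fin j → E,
      |covIter g f j x v| ≤ C * ∏ i, √(g x (v i) (v i)) := by
  obtain ⟨C₁, hC₁, hn⟩ := exists_norm_le_mul_sqrt hK (hg.continuousOn.mono hKO)
    fun x hx => hpos x (hKO hx)
  have hcont := (contDiffOn_covIter hO hg (fun x hx => isInvertible_of_pos (hpos x hx)) hf
    j).continuousOn
  have hcomp : IsCompact (K ×ˢ (Set.univ.pi fun _ : Fin j => Metric.sphere (0 : E) 1)) :=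
    hK.prod (isCompact_univ_pi fun _ => isCompact_sphere _ _)
  obtain ⟨C₂, hC₂⟩ := hcomp.exists_bound_of_continuousOn
    (hcont.mono (Set.prod_mono hKO (Set.subset_univ _)))
  refine ⟨max C₂ 0 * C₁ ^ j, by positivity, fun x hx v => ?_⟩
  by_cases h0 : ∃ i, v i = 0
  · obtain ⟨i, hi⟩ := h0
    have h1 := covIter_smul g f j x (Function.update 1 i 0) v
    have h2 : (fun k => (Function.update (1 : Fin j → ℝ) i 0) k • v k) = v := by
      funext k
      rcases eq_or_ne k i with rfl | hk
      · simp [hi]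
      · simp [Function.update_of_ne hk]
    rw [h2, Finset.prod_eq_zero (Finset.mem_univ i) (Function.update_self ..), zero_mul] at h1
    rw [h1, abs_zero]
    positivity
  push Not at h0
  have hnorm : ∀ i, 0 < ‖v i‖ := fun i => norm_pos_iff.2 (h0 i)
  have h1 := covIter_smul g f j x (fun i => ‖v i‖) fun i => ‖v i‖⁻¹ • v i
  have h2 : (fun i => ‖v i‖ • ‖v i‖⁻¹ • v i) = v := by
    funext i
    rw [smul_inv_smul₀ (hnorm i).ne']
  have h3 := hC₂ (x, fun i => ‖v i‖⁻¹ • v i) ⟨hx, fun i _ => by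
    simp [norm_smul, (hnorm i).ne']⟩
  rw [h2] at h1
  rw [h1, abs_mul, abs_of_nonneg (by positivity)]
  calc (∏ i, ‖v i‖) * |covIter g f j x fun i => ‖v i‖⁻¹ • v i|
      ≤ (∏ i, C₁ * √(g x (v i) (v i))) * max C₂ 0 := by
        gcongr with i
        · exact hn x hx (v i)
        · exact h3.trans (le_max_left _ _)
    _ = _ := by
      rw [Finset.prod_mul_distrib, Finset.prod_const, Finset.card_univ, Fintype.card_fin]
      ring

end Coordinates

section BilinearForms

set_option synthInstance.maxHeartbeats 400000
set_option maxSynthPendingDepth 3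

/-! ### Bilinear forms on the tangent bundle in charts -/

section TangentForms

variable {E : Type*} [NormedAddCommGroup E] [NormedSpace ℝ E]
  {H : Type*} [TopologicalSpace H] (I : ModelWithCorners ℝ E H) [I.Boundaryless]
  {M : Type*} [TopologicalSpace M] [ChartedSpace H M]

/-- The coordinate expression of a family of bilinear forms on the tangent spaces. -/
noncomputable def formInChart (b : ∀ q : M, TangentSpace I q →L[ℝ] TangentSpace I q →L[ℝ] ℝ) (c : M)
    (x : E) : E →L[ℝ] E →L[ℝ] ℝ :=
  let q : M := (extChartAt I c).symm x
  let A : E →L[ℝ] E := mfderiv 𝓘(ℝ, E) I (extChartAt I c).symm x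
  ContinuousLinearMap.bilinearComp (E := E) (F := E) (b q) A A

variable [IsManifold I ∞ M]

theorem trivializationAt_form_eq (b : ∀ q : M, TangentSpace I q →L[ℝ] TangentSpace I q →L[ℝ] ℝ)
    (c : M) {q : M} (hq : q ∈ (chartAt H c).source) :
    (trivializationAt (E →L[ℝ] E →L[ℝ] ℝ)
      (fun q : M => TangentSpace I q →L[ℝ] TangentSpace I q →L[ℝ] ℝ) c ⟨q, b q⟩).2 =
      formInChart I b c (extChartAt I c q) := by
  have hM : IsManifold I 1 M := .of_le (n := ∞) (by simp)
  rw [hom_trivializationAt_apply]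
  refine ContinuousLinearMap.ext fun v => ContinuousLinearMap.ext fun w => ?_
  have hs := TangentBundle.symmL_trivializationAt (I := I) hq
  rw [I.range_eq_univ, mfderivWithin_univ] at hs
  have h1 : ∀ v, (trivializationAt E (TangentSpace I) c).symm q v =
      mfderiv 𝓘(ℝ, E) I (extChartAt I c).symm (extChartAt I c q) v := fun v =>
    (Trivialization.symmL_apply (R := ℝ) _ (by simpa using hq) v).symm.trans (congrArg (fun A : E →L[ℝ] E => A v) hs)
  have h2 : (extChartAt I c).symm (extChartAt I c q) = q :=
    (extChartAt I c).left_inv (by rwa [extChartAt_source])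
  have h3 : formInChart I b c (extChartAt I c q) v w =
      b q ((trivializationAt E (TangentSpace I) c).symm q v)
        ((trivializationAt E (TangentSpace I) c).symm q w) := by
    rw [h1, h1]
    have key : ∀ (q' : M) (A : E →L[ℝ] E), q' = q →
        ContinuousLinearMap.bilinearComp (E := E) (F := E) (b q') A A v w =
          (show E →L[ℝ] E →L[ℝ] ℝ from b q) (A v) (A w) := by
      rintro _ A rfl; rfl
    exact key _ _ h2
  rw [h3]
  have := inCoordinates_apply_eq₂ (F₁ := E) (E₁ := TangentSpace I) (F₂ := E)
    (E₂ := TangentSpace I) (F₃ := ℝ) (E₃ := Bundle.Trivial M ℝ) (ϕ := b q) (v := v) (w := w)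
    (x₀ := c) (x := q)
    (by simpa using hq) (by simpa using hq) (by simp)
  refine this.trans ?_
  simp

variable {I} in
theorem contDiffOn_formInChart {b : ∀ q : M, TangentSpace I q →L[ℝ] TangentSpace I q →L[ℝ] ℝ}
    (hb : ContMDiff I (I.prod 𝓘(ℝ, E →L[ℝ] E →L[ℝ] ℝ)) ∞
      (fun q => TotalSpace.mk' (E →L[ℝ] E →L[ℝ] ℝ)
        (E := fun q : M => TangentSpace I q →L[ℝ] TangentSpace I q →L[ℝ] ℝ) q (b q))) (c : M) :
    ContDiffOn ℝ ∞ (formInChart I b c) (extChartAt I c).target := by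
  intro x hx
  refine ContDiffAt.contDiffWithinAt ?_
  have hq : (extChartAt I c).symm x ∈ (chartAt H c).source := by
    rw [← extChartAt_source I]
    exact (extChartAt I c).map_target hx
  have h1 : ContMDiffAt I 𝓘(ℝ, E →L[ℝ] E →L[ℝ] ℝ) ∞ (fun q =>
      (trivializationAt (E →L[ℝ] E →L[ℝ] ℝ)
        (fun q : M => TangentSpace I q →L[ℝ] TangentSpace I q →L[ℝ] ℝ) c ⟨q, b q⟩).2)
      ((extChartAt I c).symm x) :=
    (Bundle.Trivialization.contMDiffAt_section_iff _ (by simpa using hq)).1 hb.contMDiffAt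
  have h2 : ContMDiffAt 𝓘(ℝ, E) I ∞ (extChartAt I c).symm x :=
    (contMDiffOn_extChartAt_symm c).contMDiffAt ((isOpen_extChartAt_target c).mem_nhds hx)
  have h3 := (h1.comp x h2).contDiffAt
  refine h3.congr_of_eventuallyEq ?_
  filter_upwards [(isOpen_extChartAt_target c).mem_nhds hx] with y hy
  have hyq : (extChartAt I c).symm y ∈ (chartAt H c).source := by
    rw [← extChartAt_source I]
    exact (extChartAt I c).map_target hy
  rw [Function.comp_apply, trivializationAt_form_eq I b c hyq, (extChartAt I c).right_inv hy]

variable {I} in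
theorem contMDiff_of_contDiffOn_formInChart
    {b : ∀ q : M, TangentSpace I q →L[ℝ] TangentSpace I q →L[ℝ] ℝ}
    (hb : ∀ c : M, ContDiffOn ℝ ∞ (formInChart I b c) (extChartAt I c).target) :
    ContMDiff I (I.prod 𝓘(ℝ, E →L[ℝ] E →L[ℝ] ℝ)) ∞
      (fun q => TotalSpace.mk' (E →L[ℝ] E →L[ℝ] ℝ)
        (E := fun q : M => TangentSpace I q →L[ℝ] TangentSpace I q →L[ℝ] ℝ) q (b q)) := by
  intro c
  rw [Bundle.contMDiffAt_section]
  have h1 : ContMDiffAt 𝓘(ℝ, E) 𝓘(ℝ, E →L[ℝ] E →L[ℝ] ℝ) ∞ (formInChart I b c)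
      (extChartAt I c c) :=
    ((hb c).contDiffAt (extChartAt_target_mem_nhds c)).contMDiffAt
  refine (h1.comp c contMDiffAt_extChartAt).congr_of_eventuallyEq ?_
  filter_upwards [(chartAt H c).open_source.mem_nhds (mem_chart_source H c)] with q hq
  exact trivializationAt_form_eq I b c hq

end TangentForms

section Cylinder

variable {n : ℕ} {Y : Type*} [TopologicalSpace Y] [ChartedSpace (EuclideanSpace ℝ (Fin n)) Y]

/-- The coordinate on the half-line. -/
theorem extChartAt_rayOne (r₀ : rayOne) :
    (∀ r : rayOne, extChartAt 𝓘(ℝ, ℝ) r₀ r = (r : ℝ)) ∧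
    (extChartAt 𝓘(ℝ, ℝ) r₀).source = Set.univ ∧
    (extChartAt 𝓘(ℝ, ℝ) r₀).target = Set.Ioi 1 := by
  have h1 : ∀ r : rayOne, extChartAt 𝓘(ℝ, ℝ) r₀ r = (r : ℝ) := fun r => rfl
  have h2 : (extChartAt 𝓘(ℝ, ℝ) r₀).source = Set.univ := by
    rw [extChartAt_source, TopologicalSpace.Opens.chartAt_eq]
    simp [chartAt_self_eq]
  refine ⟨h1, h2, ?_⟩
  rw [← (extChartAt 𝓘(ℝ, ℝ) r₀).image_source_eq_target, h2, Set.image_univ]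
  ext x
  constructor
  · rintro ⟨r, rfl⟩
    exact r.2
  · intro hx
    exact ⟨⟨x, hx⟩, rfl⟩

theorem extChartAt_rayOne_symm (r₀ : rayOne) {x : ℝ} (hx : 1 < x) :
    (extChartAt 𝓘(ℝ, ℝ) r₀).symm x = ⟨x, hx⟩ := by
  have h := extChartAt_rayOne r₀
  have h1 : x ∈ (extChartAt 𝓘(ℝ, ℝ) r₀).target := h.2.2 ▸ hx
  apply Subtype.ext
  have := (extChartAt 𝓘(ℝ, ℝ) r₀).right_inv h1
  rwa [h.1] at this

theorem hasMFDerivAt_extChartAt_rayOne_symm (r₀ : rayOne) {x : ℝ} (hx : 1 < x) :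
    HasMFDerivAt 𝓘(ℝ, ℝ) 𝓘(ℝ, ℝ) (extChartAt 𝓘(ℝ, ℝ) r₀).symm x
      (ContinuousLinearMap.id ℝ ℝ) := by
  have h := extChartAt_rayOne r₀
  have h1 : x ∈ (extChartAt 𝓘(ℝ, ℝ) r₀).target := h.2.2 ▸ hx
  refine ⟨continuousAt_extChartAt_symm'' h1, ?_⟩
  refine ((hasFDerivAt_id x).congr_of_eventuallyEq ?_).hasFDerivWithinAt
  filter_upwards [isOpen_Ioi.mem_nhds hx] with y hy
  have : writtenInExtChartAt 𝓘(ℝ, ℝ) 𝓘(ℝ, ℝ) x (extChartAt 𝓘(ℝ, ℝ) r₀).symm y =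
    (((extChartAt 𝓘(ℝ, ℝ) r₀).symm y : rayOne) : ℝ) := rfl
  rw [this, extChartAt_rayOne_symm r₀ hy]
  rfl

variable [IsManifold (𝓡 n) ∞ Y]
  (h : ContMDiffRiemannianMetric (𝓡 n) ∞ (EuclideanSpace ℝ (Fin n))
      (fun y : Y => TangentSpace (𝓡 n) y))

/-- The coordinate expression of the metric on the base of the cylinder. -/
noncomputable abbrev baseMetricInChart (c : Y) :
    EuclideanSpace ℝ (Fin n) →
      EuclideanSpace ℝ (Fin n) →L[ℝ] EuclideanSpace ℝ (Fin n) →L[ℝ] ℝ :=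
  formInChart (𝓡 n) h.inner c

theorem extChartAt_cylinder (c : CylindricalEnd h) :
    extChartAt ((𝓡 n).prod 𝓘(ℝ, ℝ)) c = (extChartAt (𝓡 n) c.1).prod (extChartAt 𝓘(ℝ, ℝ) c.2) :=
  extChartAt_prod (I := 𝓡 n) (I' := 𝓘(ℝ, ℝ)) (M := Y) (M' := rayOne) c

theorem extChartAt_cylinder_apply (c p : CylindricalEnd h) :
    extChartAt ((𝓡 n).prod 𝓘(ℝ, ℝ)) c p = (extChartAt (𝓡 n) c.1 p.1, (p.2 : ℝ)) := by
  rw [extChartAt_cylinder]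
  rfl

theorem extChartAt_cylinder_target (c : CylindricalEnd h) :
    (extChartAt ((𝓡 n).prod 𝓘(ℝ, ℝ)) c).target = (extChartAt (𝓡 n) c.1).target ×ˢ Set.Ioi 1 := by
  rw [extChartAt_cylinder, PartialEquiv.prod_target, (extChartAt_rayOne c.2).2.2]

theorem mem_extChartAt_cylinder_source {c p : CylindricalEnd h} :
    p ∈ (extChartAt ((𝓡 n).prod 𝓘(ℝ, ℝ)) c).source ↔ p.1 ∈ (extChartAt (𝓡 n) c.1).source := by
  rw [extChartAt_cylinder h, PartialEquiv.prod_source, (extChartAt_rayOne c.2).2.1]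
  exact and_iff_left trivial

theorem extChartAt_cylinder_symm (c : CylindricalEnd h) (x : EuclideanSpace ℝ (Fin n)) {r : ℝ}
    (hr : 1 < r) :
    (extChartAt ((𝓡 n).prod 𝓘(ℝ, ℝ)) c).symm (x, r) = ((extChartAt (𝓡 n) c.1).symm x, (⟨r, hr⟩ : rayOne)) := by
  rw [extChartAt_cylinder, ← extChartAt_rayOne_symm c.2 hr]
  rfl

theorem mfderiv_extChartAt_cylinder_symm (c : CylindricalEnd h) {x : EuclideanSpace ℝ (Fin n)}
    (hx : x ∈ (extChartAt (𝓡 n) c.1).target) {r : ℝ} (hr : 1 < r) (v : EuclideanSpace ℝ (Fin n))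
    (s : ℝ) :
    (show EuclideanSpace ℝ (Fin n) × ℝ from
      mfderiv 𝓘(ℝ, EuclideanSpace ℝ (Fin n) × ℝ) ((𝓡 n).prod 𝓘(ℝ, ℝ)) (extChartAt ((𝓡 n).prod 𝓘(ℝ, ℝ)) c).symm (x, r) (v, s)) =
      (mfderiv 𝓘(ℝ, EuclideanSpace ℝ (Fin n)) (𝓡 n) (extChartAt (𝓡 n) c.1).symm x v, s) := by
  have hM : IsManifold (𝓡 n) 1 Y := .of_le (n := ∞) (by simp)
  have h1 : MDifferentiableAt 𝓘(ℝ, EuclideanSpace ℝ (Fin n)) (𝓡 n)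
      (extChartAt (𝓡 n) c.1).symm x :=
    ((contMDiffOn_extChartAt_symm (n := 1) c.1).contMDiffAt
      ((isOpen_extChartAt_target c.1).mem_nhds hx)).mdifferentiableAt (by simp)
  have h2 := hasMFDerivAt_extChartAt_rayOne_symm c.2 hr
  have h3 := HasMFDerivAt.prodMap (p := (x, r)) h1.hasMFDerivAt h2
  rw [h2.mfderiv] at h3
  have h4 : HasMFDerivAt 𝓘(ℝ, EuclideanSpace ℝ (Fin n) × ℝ) ((𝓡 n).prod 𝓘(ℝ, ℝ))
      (M' := Y × rayOne)
      (Prod.map (extChartAt (𝓡 n) c.1).symm (extChartAt 𝓘(ℝ, ℝ) c.2).symm) (x, r)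
      ((mfderiv 𝓘(ℝ, EuclideanSpace ℝ (Fin n)) (𝓡 n) (extChartAt (𝓡 n) c.1).symm x).prodMap
        (ContinuousLinearMap.id ℝ ℝ)) := by
    rw [modelWithCornersSelf_prod, ← chartedSpaceSelf_prod]
    exact h3
  rw [extChartAt_cylinder]
  exact congrArg (fun A : EuclideanSpace ℝ (Fin n) × ℝ →L[ℝ] EuclideanSpace ℝ (Fin n) × ℝ =>
    A (v, s)) h4.mfderiv

theorem metricInChart_cylinder (c : CylindricalEnd h) {x : EuclideanSpace ℝ (Fin n)}
    (hx : x ∈ (extChartAt (𝓡 n) c.1).target) {r : ℝ} (hr : 1 < r) :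
    metricInChart ((𝓡 n).prod 𝓘(ℝ, ℝ)) c (x, r) = addSqForm (baseMetricInChart h c.1 x) := by
  refine ContinuousLinearMap.ext fun v => ContinuousLinearMap.ext fun w => ?_
  have h1 : metricInChart ((𝓡 n).prod 𝓘(ℝ, ℝ)) c (x, r) v w =
      addSqForm (F := EuclideanSpace ℝ (Fin n)) (h.inner ((extChartAt ((𝓡 n).prod 𝓘(ℝ, ℝ)) c).symm (x, r)).1)
       (mfderiv 𝓘(ℝ, EuclideanSpace ℝ (Fin n) × ℝ) ((𝓡 n).prod 𝓘(ℝ, ℝ)) (extChartAt ((𝓡 n).prod 𝓘(ℝ, ℝ)) c).symm (x, r) v)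
       (mfderiv 𝓘(ℝ, EuclideanSpace ℝ (Fin n) × ℝ) ((𝓡 n).prod 𝓘(ℝ, ℝ)) (extChartAt ((𝓡 n).prod 𝓘(ℝ, ℝ)) c).symm (x, r) w) := by
    rfl
  obtain ⟨v, s⟩ := v
  obtain ⟨w, t⟩ := w
  refine h1.trans ?_
  have hv := mfderiv_extChartAt_cylinder_symm h c hx hr v s
  have hw := mfderiv_extChartAt_cylinder_symm h c hx hr w t
  have hb : ((extChartAt ((𝓡 n).prod 𝓘(ℝ, ℝ)) c).symm (x, r)).1 = (extChartAt (𝓡 n) c.1).symm x := by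
    rw [extChartAt_cylinder_symm h c x hr]
  have key : ∀ (q : Y) (v' w' : EuclideanSpace ℝ (Fin n) × ℝ), q = (extChartAt (𝓡 n) c.1).symm x →
      v' = (mfderiv 𝓘(ℝ, EuclideanSpace ℝ (Fin n)) (𝓡 n) (extChartAt (𝓡 n) c.1).symm x v, s) →
      w' = (mfderiv 𝓘(ℝ, EuclideanSpace ℝ (Fin n)) (𝓡 n) (extChartAt (𝓡 n) c.1).symm x w, t) →
      (show EuclideanSpace ℝ (Fin n) →L[ℝ] EuclideanSpace ℝ (Fin n) →L[ℝ] ℝ from h.inner q) v'.1 w'.1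
        + v'.2 * w'.2 = baseMetricInChart h c.1 x v w + s * t := by
    rintro _ _ _ rfl rfl rfl
    rfl
  exact key _ _ _ hb hv hw

theorem baseMetricInChart_pos (c : Y) {x : EuclideanSpace ℝ (Fin n)}
    (hx : x ∈ (extChartAt (𝓡 n) c).target) {v : EuclideanSpace ℝ (Fin n)} (hv : v ≠ 0) :
    0 < baseMetricInChart h c x v v := by
  have hM : IsManifold (𝓡 n) 1 Y := .of_le (n := ∞) (by simp)
  refine h.pos _ _ fun h0 => hv ?_
  have hinv := isInvertible_mfderivWithin_extChartAt_symm (I := 𝓡 n) hx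
  rw [ModelWithCorners.range_eq_univ, mfderivWithin_univ] at hinv
  exact hinv.injective (h0.trans (map_zero _).symm)

theorem contDiffOn_baseMetricInChart (c : Y) :
    ContDiffOn ℝ ∞ (baseMetricInChart h c) (extChartAt (𝓡 n) c).target :=
  contDiffOn_formInChart h.contMDiff c

theorem ContDiffOn.addSqForm {P F : Type*} [NormedAddCommGroup P] [NormedSpace ℝ P]
    [NormedAddCommGroup F] [NormedSpace ℝ F] {b : P → F →L[ℝ] F →L[ℝ] ℝ} {s : Set P}
    {k : WithTop ℕ∞} (hb : ContDiffOn ℝ k b s) : ContDiffOn ℝ k (fun p => addSqForm (b p)) s := by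
  unfold _root_.addSqForm ContinuousLinearMap.bilinearComp
  exact ((((hb.clm_comp contDiffOn_const).clm_flip).clm_comp contDiffOn_const).clm_flip).add
    contDiffOn_const

/-- The metric `dr² + h` in coordinates on `Y × ℝ`. -/
noncomputable abbrev cylMetric (c : Y) (z : EuclideanSpace ℝ (Fin n) × ℝ) :
    EuclideanSpace ℝ (Fin n) × ℝ →L[ℝ] EuclideanSpace ℝ (Fin n) × ℝ →L[ℝ] ℝ :=
  addSqForm (baseMetricInChart h c z.1)

theorem contDiffOn_cylMetric (c : Y) :
    ContDiffOn ℝ ∞ (cylMetric h c) ((extChartAt (𝓡 n) c).target ×ˢ Set.univ) :=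
  ((contDiffOn_baseMetricInChart h c).comp contDiffOn_fst fun _ hz => hz.1).addSqForm

theorem cylMetric_pos (c : Y) {z : EuclideanSpace ℝ (Fin n) × ℝ}
    (hz : z ∈ (extChartAt (𝓡 n) c).target ×ˢ (Set.univ : Set ℝ))
    (v : EuclideanSpace ℝ (Fin n) × ℝ) (hv : v ≠ 0) : 0 < cylMetric h c z v v :=
  addSqForm_pos _ (fun _ => baseMetricInChart_pos h c hz.1) v hv

theorem metricInChart_cylinder_eq (c : CylindricalEnd h) {z : EuclideanSpace ℝ (Fin n) × ℝ}
    (hz : z ∈ (extChartAt (𝓡 n) c.1).target ×ˢ Set.Ioi (1 : ℝ)) :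
    metricInChart ((𝓡 n).prod 𝓘(ℝ, ℝ)) c z = cylMetric h c.1 z :=
  metricInChart_cylinder h c hz.1 hz.2

instance : IsContinuousRiemannianBundle (EuclideanSpace ℝ (Fin n) × ℝ)
    (fun p : CylindricalEnd h => TangentSpace ((𝓡 n).prod 𝓘(ℝ, ℝ)) p) := by
  refine ⟨(cylinderMetric h).inner, ?_, fun p v w => rfl⟩
  refine (contMDiff_of_contDiffOn_formInChart (I := (𝓡 n).prod 𝓘(ℝ, ℝ)) fun c => ?_).continuous
  rw [extChartAt_cylinder_target]
  exact ((contDiffOn_cylMetric h c.1).mono (Set.prod_mono_right (Set.subset_univ _))).congr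
    fun z hz => metricInChart_cylinder_eq h c hz

end Cylinder

theorem abs_fderiv_le_norm_riemGradient_mul {E : Type*} [NormedAddCommGroup E] [NormedSpace ℝ E]
    [FiniteDimensional ℝ E] {H : Type*} [TopologicalSpace H] (I : ModelWithCorners ℝ E H)
    [I.Boundaryless] {M : Type*} [TopologicalSpace M] [ChartedSpace H M] [IsManifold I ∞ M]
    [RiemannianBundle (fun x : M => TangentSpace I x)] (f : M → ℝ) (c : M) {x : E}
    (hx : x ∈ (extChartAt I c).target)
    (hf : MDifferentiableAt I 𝓘(ℝ, ℝ) f ((extChartAt I c).symm x)) (u : E) :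
    |fderiv ℝ (f ∘ (extChartAt I c).symm) x u| ≤
      ‖riemGradient I f ((extChartAt I c).symm x)‖ * √(metricInChart I c x u u) := by
  have hM : IsManifold I 1 M := .of_le (n := ∞) (by simp)
  set q : M := (extChartAt I c).symm x with hq
  have : FiniteDimensional ℝ (TangentSpace I q) := inferInstanceAs (FiniteDimensional ℝ E)
  have : CompleteSpace (TangentSpace I q) := FiniteDimensional.complete ℝ _
  have hsymm : MDifferentiableAt 𝓘(ℝ, E) I (extChartAt I c).symm x :=
    ((contMDiffOn_extChartAt_symm (n := 1) c).contMDiffAt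
      ((isOpen_extChartAt_target c).mem_nhds hx)).mdifferentiableAt (by simp)
  let w : TangentSpace I q := mfderiv 𝓘(ℝ, E) I (extChartAt I c).symm x u
  have h1 : fderiv ℝ (f ∘ (extChartAt I c).symm) x u = mfderiv I 𝓘(ℝ, ℝ) f q w := by
    rw [← mfderiv_eq_fderiv, mfderiv_comp x hf hsymm]
    rfl
  have h2 : metricInChart I c x u u = inner ℝ w w := rfl
  have h3 : (mfderiv I 𝓘(ℝ, ℝ) f q : TangentSpace I q → ℝ) w = inner ℝ (riemGradient I f q) w :=
    (InnerProductSpace.toDual_symm_apply (𝕜 := ℝ)).symm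
  rw [h2, real_inner_self_eq_norm_sq, Real.sqrt_sq (norm_nonneg _), h1]
  refine le_trans (le_of_eq (congrArg abs h3)) (abs_real_inner_le_norm _ _)

section Cylinder

variable {n : ℕ} {Y : Type*} [TopologicalSpace Y] [ChartedSpace (EuclideanSpace ℝ (Fin n)) Y]

/-- The coordinate expression of a function on `Y × ℝ`. -/
noncomputable def prodInChart (f : Y × ℝ → ℝ) (c : Y) (z : EuclideanSpace ℝ (Fin n) × ℝ) : ℝ :=
  f ((extChartAt (𝓡 n) c).symm z.1, z.2)

theorem prodInChart_eq (f : Y × ℝ → ℝ) (c : Y) (s : ℝ) :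
    prodInChart f c = f ∘ (extChartAt ((𝓡 n).prod 𝓘(ℝ, ℝ)) (c, s)).symm := by
  rw [extChartAt_prod]
  rfl

theorem extChartAt_prod_real_target (c : Y) (s : ℝ) :
    (extChartAt ((𝓡 n).prod 𝓘(ℝ, ℝ)) (c, s)).target =
      (extChartAt (𝓡 n) c).target ×ˢ (Set.univ : Set ℝ) := by
  rw [extChartAt_prod, PartialEquiv.prod_target, extChartAt_model_space_eq_id]
  rfl

theorem isOpen_target_prod_univ (c : Y) :
    IsOpen ((extChartAt (𝓡 n) c).target ×ˢ (Set.univ : Set ℝ)) :=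
  (isOpen_extChartAt_target c).prod isOpen_univ

theorem exists_finite_compact_charts [CompactSpace Y] [T2Space Y] :
    ∃ (t : Finset Y) (K : Y → Set Y), (∀ c, IsCompact (K c)) ∧
      (∀ c, K c ⊆ (extChartAt (𝓡 n) c).source) ∧ ∀ y, ∃ c ∈ t, y ∈ K c := by
  have hK : ∀ c : Y, ∃ K : Set Y, IsCompact K ∧ K ∈ 𝓝 c ∧ K ⊆ (extChartAt (𝓡 n) c).source := by
    intro c
    obtain ⟨K, hK, hKs, hKc⟩ := exists_mem_nhds_isCompact_mapsTo (f := id) continuous_id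
      (extChartAt_source_mem_nhds (I := 𝓡 n) c)
    exact ⟨K, hKs, hK, hKc⟩
  choose K hKc hKn hKs using hK
  obtain ⟨t, ht⟩ := finite_cover_nhds hKn
  refine ⟨t, K, hKc, hKs, fun y => ?_⟩
  have := ht.symm ▸ Set.mem_univ y
  simpa using this

variable [IsManifold (𝓡 n) ∞ Y]
  (h : ContMDiffRiemannianMetric (𝓡 n) ∞ (EuclideanSpace ℝ (Fin n))
      (fun y : Y => TangentSpace (𝓡 n) y))

theorem contDiffOn_prodInChart {f : Y × ℝ → ℝ}
    (hf : ContMDiff ((𝓡 n).prod 𝓘(ℝ, ℝ)) 𝓘(ℝ, ℝ) ∞ f) (c : Y) :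
    ContDiffOn ℝ ∞ (prodInChart f c) ((extChartAt (𝓡 n) c).target ×ˢ Set.univ) := by
  rw [prodInChart_eq f c 0, ← extChartAt_prod_real_target c 0, ← contMDiffOn_iff_contDiffOn]
  exact hf.comp_contMDiffOn (contMDiffOn_extChartAt_symm _)

theorem exists_fderiv_prodInChart_ne_zero {f : Y × ℝ → ℝ}
    (hf : ContMDiff ((𝓡 n).prod 𝓘(ℝ, ℝ)) 𝓘(ℝ, ℝ) ∞ f) {z : Y × ℝ}
    (hz : mfderiv ((𝓡 n).prod 𝓘(ℝ, ℝ)) 𝓘(ℝ, ℝ) f z ≠ 0) :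
    ∃ u, fderiv ℝ (prodInChart f z.1) (extChartAt (𝓡 n) z.1 z.1, z.2) u ≠ 0 := by
  by_contra! hall
  apply hz
  have hM : IsManifold ((𝓡 n).prod 𝓘(ℝ, ℝ)) 1 (Y × ℝ) := .of_le (n := ∞) (by simp)
  set φ := extChartAt ((𝓡 n).prod 𝓘(ℝ, ℝ)) z with hφ
  have hpt : φ z = (extChartAt (𝓡 n) z.1 z.1, z.2) := by
    rw [hφ, extChartAt_prod]
    rfl
  have hzt : φ z ∈ φ.target := φ.map_source (mem_extChartAt_source z)
  have h0 : fderiv ℝ (f ∘ φ.symm) (φ z) = 0 := by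
    rw [hpt]
    refine ContinuousLinearMap.ext fun u => ?_
    rw [← prodInChart_eq f z.1 z.2]
    exact hall u
  have hinv := isInvertible_mfderivWithin_extChartAt_symm (I := (𝓡 n).prod 𝓘(ℝ, ℝ)) hzt
  rw [ModelWithCorners.range_eq_univ, mfderivWithin_univ] at hinv
  have hsymm : MDifferentiableAt 𝓘(ℝ, EuclideanSpace ℝ (Fin n) × ℝ) ((𝓡 n).prod 𝓘(ℝ, ℝ))
      φ.symm (φ z) :=
    ((contMDiffOn_extChartAt_symm (n := 1) z).contMDiffAt
      ((isOpen_extChartAt_target z).mem_nhds hzt)).mdifferentiableAt (by simp)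
  rw [← mfderiv_eq_fderiv, mfderiv_comp (φ z) (hf.mdifferentiable (by simp) _) hsymm] at h0
  have hleft : φ.symm (φ z) = z := φ.left_inv (mem_extChartAt_source z)
  obtain ⟨e, he⟩ := hinv
  rw [← hleft]
  refine ContinuousLinearMap.ext fun v => ?_
  have h2 := congrArg (fun A : EuclideanSpace ℝ (Fin n) × ℝ →L[ℝ] ℝ => A (e.symm v)) h0
  have h3 : mfderiv 𝓘(ℝ, EuclideanSpace ℝ (Fin n) × ℝ) ((𝓡 n).prod 𝓘(ℝ, ℝ)) φ.symm (φ z)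
      (e.symm v) = v := by
    rw [← he]
    exact e.apply_symm_apply v
  refine Eq.trans ?_ h2
  exact (congrArg (mfderiv ((𝓡 n).prod 𝓘(ℝ, ℝ)) 𝓘(ℝ, ℝ) f (φ.symm (φ z))) h3).symm

variable {h} in
theorem eventually_chart_eq_translate {ψ : CylindricalEnd h → ℝ} {f : Y × ℝ → ℝ} {τ : ℝ}
    {p : CylindricalEnd h} (hψ : ∀ᶠ q in 𝓝 p, ψ q = f (q.1, (q.2 : ℝ) - τ)) (c : CylindricalEnd h)
    (hp : p.1 ∈ (extChartAt (𝓡 n) c.1).source) :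
    ∀ᶠ z in 𝓝 (extChartAt ((𝓡 n).prod 𝓘(ℝ, ℝ)) c p),
      (ψ ∘ (extChartAt ((𝓡 n).prod 𝓘(ℝ, ℝ)) c).symm) z = prodInChart f c.1 (z + (0, -τ)) := by
  have hps : p ∈ (extChartAt ((𝓡 n).prod 𝓘(ℝ, ℝ)) c).source :=
    (mem_extChartAt_cylinder_source h).2 hp
  have htend : Filter.Tendsto (extChartAt ((𝓡 n).prod 𝓘(ℝ, ℝ)) c).symm
      (𝓝 (extChartAt ((𝓡 n).prod 𝓘(ℝ, ℝ)) c p)) (𝓝 p) := by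
    have := continuousAt_extChartAt_symm' hps
    rwa [ContinuousAt, (extChartAt ((𝓡 n).prod 𝓘(ℝ, ℝ)) c).left_inv hps] at this
  filter_upwards [htend.eventually hψ, (isOpen_extChartAt_target c).mem_nhds
    ((extChartAt ((𝓡 n).prod 𝓘(ℝ, ℝ)) c).map_source hps)] with z hz hzt
  rw [Function.comp_apply, hz]
  rw [extChartAt_cylinder_target] at hzt
  obtain ⟨x, r⟩ := z
  rw [extChartAt_cylinder_symm h c x hzt.2]
  simp [prodInChart, sub_eq_add_neg]

variable {h} in
theorem contMDiff_of_eventually_eq_translate {ψ : CylindricalEnd h → ℝ}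
    (hψ : ∀ p : CylindricalEnd h, ∃ f : Y × ℝ → ℝ, ∃ τ : ℝ,
      ContMDiff ((𝓡 n).prod 𝓘(ℝ, ℝ)) 𝓘(ℝ, ℝ) ∞ f ∧
      ∀ᶠ q in 𝓝 p, ψ q = f (q.1, (q.2 : ℝ) - τ)) :
    ContMDiff ((𝓡 n).prod 𝓘(ℝ, ℝ)) 𝓘(ℝ, ℝ) ∞ ψ := by
  intro p
  obtain ⟨f, τ, hf, hev⟩ := hψ p
  have h1 := eventually_chart_eq_translate hev p (mem_extChartAt_source p.1)
  set φ := extChartAt ((𝓡 n).prod 𝓘(ℝ, ℝ)) p with hφ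
  have hpt : φ p + (0, -τ) ∈ (extChartAt (𝓡 n) p.1).target ×ˢ (Set.univ : Set ℝ) := by
    refine ⟨?_, Set.mem_univ _⟩
    rw [hφ, extChartAt_cylinder_apply]
    simp
  have h2 : ContDiffAt ℝ ∞ (fun z => prodInChart f p.1 (z + (0, -τ))) (φ p) := by
    refine ContDiffAt.comp (g := prodInChart f p.1) (f := fun z => z + (0, -τ)) (φ p) ?_
      (contDiffAt_id.add contDiffAt_const)
    exact (contDiffOn_prodInChart hf p.1).contDiffAt ((isOpen_target_prod_univ p.1).mem_nhds hpt)
  have h3 : ContDiffAt ℝ ∞ (ψ ∘ φ.symm) (φ p) := h2.congr_of_eventuallyEq h1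
  refine (h3.contMDiffAt.comp p contMDiffAt_extChartAt).congr_of_eventuallyEq ?_
  filter_upwards [extChartAt_source_mem_nhds (I := (𝓡 n).prod 𝓘(ℝ, ℝ)) p] with q hq
  rw [Function.comp_apply, Function.comp_apply, φ.left_inv hq]

variable [CompactSpace Y]

variable {h} in
/-- A function that is locally one of finitely many functions, translated along the cylinder, is
in `C_b^∞`. -/
theorem isCbInfty_of_eventually_eq_translate [T2Space Y] {ψ : CylindricalEnd h → ℝ} {ι : Type*} [Finite ι]
    {f : ι → Y × ℝ → ℝ} (hf : ∀ i, ContMDiff ((𝓡 n).prod 𝓘(ℝ, ℝ)) 𝓘(ℝ, ℝ) ∞ (f i)) {r₀ r₁ : ℝ}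
    (hψ : ∀ p : CylindricalEnd h, ∃ i, ∃ τ : ℝ, (p.2 : ℝ) - τ ∈ Set.Icc r₀ r₁ ∧
      ∀ᶠ q in 𝓝 p, ψ q = f i (q.1, (q.2 : ℝ) - τ)) :
    IsCbInfty ((𝓡 n).prod 𝓘(ℝ, ℝ)) ψ := by
  refine ⟨contMDiff_of_eventually_eq_translate fun p => ?_, fun j => ?_⟩
  · obtain ⟨i, τ, -, hev⟩ := hψ p
    exact ⟨f i, τ, hf i, hev⟩
  obtain ⟨t, K, hKc, hKs, hKt⟩ := exists_finite_compact_charts (n := n) (Y := Y)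
  have hbound : ∀ (c : Y) (i : ι), ∃ C : ℝ, 0 ≤ C ∧
      ∀ z ∈ (extChartAt (𝓡 n) c '' K c) ×ˢ Set.Icc r₀ r₁, ∀ v : Fin j → _,
        |covIter (cylMetric h c) (prodInChart (f i) c) j z v| ≤
          C * ∏ k, √(cylMetric h c z (v k) (v k)) := by
    intro c i
    refine exists_covIter_le (isOpen_target_prod_univ c) (contDiffOn_cylMetric h c)
      (fun z hz v hv => cylMetric_pos h c hz v hv) (contDiffOn_prodInChart (hf i) c)
      (((hKc c).image_of_continuousOn ((continuousOn_extChartAt c).mono (hKs c))).prod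
        isCompact_Icc) (Set.prod_mono ?_ (Set.subset_univ _)) j
    rintro _ ⟨y, hy, rfl⟩
    exact (extChartAt (𝓡 n) c).map_source (hKs c hy)
  choose C hC0 hC using hbound
  obtain ⟨D, hD⟩ := (Set.finite_range fun q : t × ι => C q.1 q.2).bddAbove
  refine ⟨D, fun p => ?_⟩
  obtain ⟨c, hct, hpc⟩ := hKt p.1
  obtain ⟨i, τ, hτ, hev⟩ := hψ p
  let c' : CylindricalEnd h := (c, (⟨2, by simp [rayOne]⟩ : rayOne))
  have hps : p ∈ (extChartAt ((𝓡 n).prod 𝓘(ℝ, ℝ)) c').source :=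
    (mem_extChartAt_cylinder_source h).2 (hKs c hpc)
  refine ⟨c', by rwa [extChartAt_source] at hps, fun v => ?_⟩
  have hpt : extChartAt ((𝓡 n).prod 𝓘(ℝ, ℝ)) c' p ∈
      (extChartAt (𝓡 n) c).target ×ˢ Set.Ioi (1 : ℝ) := by
    rw [← extChartAt_cylinder_target h c']
    exact (extChartAt ((𝓡 n).prod 𝓘(ℝ, ℝ)) c').map_source hps
  have hmetric : ∀ᶠ z in 𝓝 (extChartAt ((𝓡 n).prod 𝓘(ℝ, ℝ)) c' p),
      metricInChart ((𝓡 n).prod 𝓘(ℝ, ℝ)) c' z = cylMetric h c (z + (0, -τ)) := by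
    filter_upwards [((isOpen_extChartAt_target c).prod isOpen_Ioi).mem_nhds hpt] with z hz
    rw [metricInChart_cylinder_eq h c' hz]
    simp [cylMetric, c']
  have hfun := eventually_chart_eq_translate hev c' (hKs c hpc)
  have heq := (eventually_covIter_eq_translate hmetric hfun j).self_of_nhds v
  rw [iteratedCovDeriv_eq_covIter, heq]
  have hz : extChartAt ((𝓡 n).prod 𝓘(ℝ, ℝ)) c' p + (0, -τ) ∈
      (extChartAt (𝓡 n) c '' K c) ×ˢ Set.Icc r₀ r₁ := by
    rw [extChartAt_cylinder_apply]
    refine ⟨⟨p.1, hpc, by simp [c']⟩, ?_⟩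
    simpa [sub_eq_add_neg] using hτ
  refine (hC c i _ hz v).trans ?_
  rw [hmetric.self_of_nhds]
  gcongr
  exact hD ⟨(⟨c, hct⟩, i), rfl⟩

variable {h} in
/-- A lower bound of the gradient away from the critical points, for functions that are locally one
of finitely many functions translated along the cylinder. -/
theorem exists_le_norm_riemGradient {ι : Type*} [Finite ι]
    {f : ι → Y × ℝ → ℝ} (hf : ∀ i, ContMDiff ((𝓡 n).prod 𝓘(ℝ, ℝ)) 𝓘(ℝ, ℝ) ∞ (f i)) {r₀ r₁ : ℝ}
    {U : ι → Set (Y × ℝ)} (hU : ∀ i, IsOpen (U i))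
    (hcrit : ∀ i, ∀ z : Y × ℝ, z.2 ∈ Set.Icc r₀ r₁ →
      mfderiv ((𝓡 n).prod 𝓘(ℝ, ℝ)) 𝓘(ℝ, ℝ) (f i) z = 0 → z ∈ U i) :
    ∃ ρ : ℝ, 0 < ρ ∧ ∀ (ψ : CylindricalEnd h → ℝ) (p : CylindricalEnd h) (i : ι) (τ : ℝ),
      ContMDiff ((𝓡 n).prod 𝓘(ℝ, ℝ)) 𝓘(ℝ, ℝ) ∞ ψ →
      (p.2 : ℝ) - τ ∈ Set.Icc r₀ r₁ → (p.1, (p.2 : ℝ) - τ) ∉ U i →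
      (∀ᶠ q in 𝓝 p, ψ q = f i (q.1, (q.2 : ℝ) - τ)) →
      ρ ≤ ‖riemGradient ((𝓡 n).prod 𝓘(ℝ, ℝ)) ψ p‖ := by
  let Q : ι → Y × ℝ → ℝ → Prop := fun i z ρ =>
    ∀ (ψ : CylindricalEnd h → ℝ) (p : CylindricalEnd h) (τ : ℝ),
      ContMDiff ((𝓡 n).prod 𝓘(ℝ, ℝ)) 𝓘(ℝ, ℝ) ∞ ψ → (p.1, (p.2 : ℝ) - τ) = z →
      (∀ᶠ q in 𝓝 p, ψ q = f i (q.1, (q.2 : ℝ) - τ)) →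
      ρ ≤ ‖riemGradient ((𝓡 n).prod 𝓘(ℝ, ℝ)) ψ p‖
  have hloc : ∀ i, ∀ z : Y × ℝ, mfderiv ((𝓡 n).prod 𝓘(ℝ, ℝ)) 𝓘(ℝ, ℝ) (f i) z ≠ 0 →
      ∃ ρ > 0, ∀ᶠ z' in 𝓝 z, Q i z' ρ := by
    intro i z hz
    obtain ⟨u, hu⟩ := exists_fderiv_prodInChart_ne_zero (hf i) hz
    have hu0 : u ≠ 0 := by
      rintro rfl
      exact hu (map_zero _)
    set c := z.1 with hc
    set O := (extChartAt (𝓡 n) c).target ×ˢ (Set.univ : Set ℝ) with hO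
    have hOo : IsOpen O := isOpen_target_prod_univ c
    let A : EuclideanSpace ℝ (Fin n) × ℝ → ℝ := fun x =>
      |fderiv ℝ (prodInChart (f i) c) x u| / √(cylMetric h c x u u)
    have hA : ContinuousOn A O := by
      refine ContinuousOn.div ?_ ?_ ?_
      · have := (contDiffOn_prodInChart (hf i) c).continuousOn_fderiv_of_isOpen hOo (by simp)
        exact (this.clm_apply continuousOn_const).abs
      · exact Real.continuous_sqrt.comp_continuousOn
          (((contDiffOn_cylMetric h c).continuousOn.clm_apply continuousOn_const).clm_apply
            continuousOn_const)
      · intro x hx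
        exact (Real.sqrt_pos.2 (cylMetric_pos h c hx u hu0)).ne'
    set x₀ : EuclideanSpace ℝ (Fin n) × ℝ := (extChartAt (𝓡 n) c c, z.2) with hx₀
    have hx₀O : x₀ ∈ O := ⟨mem_extChartAt_target c, Set.mem_univ _⟩
    have hA0 : 0 < A x₀ :=
      div_pos (abs_pos.2 hu) (Real.sqrt_pos.2 (cylMetric_pos h c hx₀O u hu0))
    have hchart : ContinuousAt (fun z' : Y × ℝ => (extChartAt (𝓡 n) c z'.1, z'.2)) z := by
      refine ContinuousAt.prodMk ?_ continuousAt_snd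
      exact ContinuousAt.comp (f := Prod.fst) (continuousAt_extChartAt c) continuousAt_fst
    refine ⟨A x₀ / 2, by positivity, ?_⟩
    have hAc : ContinuousAt A (extChartAt (𝓡 n) c z.1, z.2) :=
      hA.continuousAt (hOo.mem_nhds hx₀O)
    have hnear := (ContinuousAt.comp
      (f := fun z' : Y × ℝ => (extChartAt (𝓡 n) c z'.1, z'.2)) hAc hchart).eventually
      (lt_mem_nhds (show A x₀ / 2 < A x₀ by linarith))
    have hsrc : ∀ᶠ z' in 𝓝 z, z'.1 ∈ (extChartAt (𝓡 n) c).source :=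
      continuousAt_fst.preimage_mem_nhds (extChartAt_source_mem_nhds c)
    filter_upwards [hnear, hsrc] with z' hz' hzs ψ p τ hψ hpz hev
    subst hpz
    let c' : CylindricalEnd h := (c, (⟨2, by simp [rayOne]⟩ : rayOne))
    have hps : p ∈ (extChartAt ((𝓡 n).prod 𝓘(ℝ, ℝ)) c').source :=
      (mem_extChartAt_cylinder_source h).2 hzs
    have hpt := (extChartAt ((𝓡 n).prod 𝓘(ℝ, ℝ)) c').map_source hps
    have key := abs_fderiv_le_norm_riemGradient_mul ((𝓡 n).prod 𝓘(ℝ, ℝ)) ψ c' hpt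
      (hψ.mdifferentiable (by simp) _) u
    have hev' := eventually_chart_eq_translate hev c' hzs
    rw [Filter.EventuallyEq.fderiv_eq (f := fun z => prodInChart (f i) c'.1 (z + (0, -τ))) hev',
      fderiv_comp_add_right, (extChartAt ((𝓡 n).prod 𝓘(ℝ, ℝ)) c').left_inv hps] at key
    rw [extChartAt_cylinder_target] at hpt
    rw [metricInChart_cylinder_eq h c' hpt] at key
    have hpe : extChartAt ((𝓡 n).prod 𝓘(ℝ, ℝ)) c' p + (0, -τ) =
        (extChartAt (𝓡 n) c p.1, (p.2 : ℝ) - τ) := by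
      rw [extChartAt_cylinder_apply]
      simp [c', sub_eq_add_neg]
    have hm : cylMetric h c'.1 (extChartAt ((𝓡 n).prod 𝓘(ℝ, ℝ)) c' p) =
        cylMetric h c (extChartAt (𝓡 n) c p.1, (p.2 : ℝ) - τ) := by
      rw [extChartAt_cylinder_apply]
    rw [hpe, hm] at key
    have hpos : 0 < √(cylMetric h c (extChartAt (𝓡 n) c p.1, (p.2 : ℝ) - τ) u u) :=
      Real.sqrt_pos.2 (cylMetric_pos h c ⟨(extChartAt (𝓡 n) c).map_source hzs, Set.mem_univ _⟩ u hu0)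
    exact hz'.le.trans ((div_le_iff₀ hpos).2 key)
  have hcomp : ∀ i, IsCompact (((Set.univ : Set Y) ×ˢ Set.Icc r₀ r₁) \ U i) := fun i =>
    (isCompact_univ.prod isCompact_Icc).diff (hU i)
  have hunif : ∀ i, ∃ ρ > 0, ∀ z ∈ ((Set.univ : Set Y) ×ˢ Set.Icc r₀ r₁) \ U i, Q i z ρ := by
    intro i
    refine (hcomp i).induction_on (p := fun s => ∃ ρ > 0, ∀ z ∈ s, Q i z ρ)
      ⟨1, one_pos, fun z hz => absurd hz (Set.notMem_empty z)⟩ ?_ ?_ ?_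
    · rintro s t hst ⟨ρ, hρ, ht⟩
      exact ⟨ρ, hρ, fun z hz => ht z (hst hz)⟩
    · rintro s t ⟨ρ, hρ, hs⟩ ⟨ρ', hρ', ht⟩
      refine ⟨min ρ ρ', lt_min hρ hρ', ?_⟩
      rintro z (hz | hz) ψ p τ h1 h2 h3
      · exact (min_le_left _ _).trans (hs z hz ψ p τ h1 h2 h3)
      · exact (min_le_right _ _).trans (ht z hz ψ p τ h1 h2 h3)
    · rintro z ⟨hz, hzU⟩
      obtain ⟨ρ, hρ, hev⟩ := hloc i z fun h0 => hzU (hcrit i z hz.2 h0)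
      exact ⟨_, mem_nhdsWithin_of_mem_nhds hev, ρ, hρ, fun z hz => hz⟩
  choose ρ hρ hQ using hunif
  obtain ⟨ρ₀, hρ₀, hle⟩ : ∃ ρ₀ > 0, ∀ i, ρ₀ ≤ ρ i := by
    rcases isEmpty_or_nonempty ι with hι | hι
    · exact ⟨1, one_pos, fun i => (hι.false i).elim⟩
    · obtain ⟨i, hi⟩ := Finite.exists_min ρ
      exact ⟨ρ i, hρ i, hi⟩
  refine ⟨ρ₀, hρ₀, fun ψ p i τ hψ hτ hUi hev => (hle i).trans ?_⟩
  exact hQ i _ ⟨⟨Set.mem_univ _, hτ⟩, hUi⟩ ψ p τ hψ rfl hev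

end Cylinder

end BilinearForms

section CylinderDistance

variable {n : ℕ} {Y : Type*} [TopologicalSpace Y] [ChartedSpace (EuclideanSpace ℝ (Fin n)) Y]

theorem hasMFDerivAt_val_rayOne (r : rayOne) :
    HasMFDerivAt 𝓘(ℝ, ℝ) 𝓘(ℝ, ℝ) (Subtype.val : rayOne → ℝ) r (ContinuousLinearMap.id ℝ ℝ) := by
  have hev : writtenInExtChartAt 𝓘(ℝ, ℝ) 𝓘(ℝ, ℝ) r (Subtype.val : rayOne → ℝ) =ᶠ[𝓝 (r : ℝ)] id := by
    filter_upwards [isOpen_Ioi.mem_nhds (show (r : ℝ) ∈ Set.Ioi 1 from r.2)] with y hy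
    exact congrArg Subtype.val (extChartAt_rayOne_symm r hy)
  exact ⟨continuousAt_subtype_val,
    ((hasFDerivAt_id _).congr_of_eventuallyEq hev).hasFDerivWithinAt⟩

/-- Translation of the half-line. -/
noncomputable def rayTranslate (τ : ℝ) (hτ : 0 ≤ τ) (r : rayOne) : rayOne :=
  ⟨r + τ, by
    have : (1 : ℝ) < r := r.2
    change (1 : ℝ) < r + τ
    linarith⟩

theorem continuous_rayTranslate (τ : ℝ) (hτ : 0 ≤ τ) : Continuous (rayTranslate τ hτ) :=
  Continuous.subtype_mk (continuous_subtype_val.add continuous_const) _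

theorem rayTranslate_chart_eventuallyEq (τ : ℝ) (hτ : 0 ≤ τ) (r : rayOne) :
    extChartAt 𝓘(ℝ, ℝ) (rayTranslate τ hτ r) ∘ rayTranslate τ hτ ∘ (extChartAt 𝓘(ℝ, ℝ) r).symm
      =ᶠ[𝓝 (extChartAt 𝓘(ℝ, ℝ) r r)] fun y => y + τ := by
  filter_upwards [isOpen_Ioi.mem_nhds (show (r : ℝ) ∈ Set.Ioi 1 from r.2)] with y hy
  rw [Function.comp_apply, Function.comp_apply, (extChartAt_rayOne _).1,
    extChartAt_rayOne_symm r hy]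
  rfl

theorem contMDiff_rayTranslate (τ : ℝ) (hτ : 0 ≤ τ) :
    ContMDiff 𝓘(ℝ, ℝ) 𝓘(ℝ, ℝ) ∞ (rayTranslate τ hτ) := by
  intro r
  rw [contMDiffAt_iff]
  refine ⟨(continuous_rayTranslate τ hτ).continuousAt, ContDiffAt.contDiffWithinAt ?_⟩
  exact (contDiffAt_id.add contDiffAt_const).congr_of_eventuallyEq
    (rayTranslate_chart_eventuallyEq τ hτ r)

theorem hasMFDerivAt_rayTranslate (τ : ℝ) (hτ : 0 ≤ τ) (r : rayOne) :
    HasMFDerivAt 𝓘(ℝ, ℝ) 𝓘(ℝ, ℝ) (rayTranslate τ hτ) r (ContinuousLinearMap.id ℝ ℝ) := by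
  refine ⟨(continuous_rayTranslate τ hτ).continuousAt, HasFDerivAt.hasFDerivWithinAt ?_⟩
  exact ((hasFDerivAt_id _).add_const τ).congr_of_eventuallyEq
    (rayTranslate_chart_eventuallyEq τ hτ r)

variable [IsManifold (𝓡 n) ∞ Y]
  {h : ContMDiffRiemannianMetric (𝓡 n) ∞ (EuclideanSpace ℝ (Fin n))
      (fun y : Y => TangentSpace (𝓡 n) y)}

/-- Translation along the cylinder. -/
noncomputable def cylTranslate (τ : ℝ) (hτ : 0 ≤ τ) (p : CylindricalEnd h) : CylindricalEnd h :=
  (p.1, rayTranslate τ hτ p.2)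

theorem contMDiff_cylTranslate (τ : ℝ) (hτ : 0 ≤ τ) :
    ContMDiff ((𝓡 n).prod 𝓘(ℝ, ℝ)) ((𝓡 n).prod 𝓘(ℝ, ℝ)) ∞ (cylTranslate (h := h) τ hτ) :=
  ContMDiff.prodMap (I := 𝓡 n) (I' := 𝓡 n) (J := 𝓘(ℝ, ℝ)) (J' := 𝓘(ℝ, ℝ)) (f := (id : Y → Y))
    contMDiff_id (contMDiff_rayTranslate τ hτ)

theorem mfderiv_cylTranslate (τ : ℝ) (hτ : 0 ≤ τ) (p : CylindricalEnd h)
    (v : EuclideanSpace ℝ (Fin n) × ℝ) :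
    (show EuclideanSpace ℝ (Fin n) × ℝ from mfderiv ((𝓡 n).prod 𝓘(ℝ, ℝ)) ((𝓡 n).prod 𝓘(ℝ, ℝ))
      (cylTranslate (h := h) τ hτ) p v) = v := by
  have h1 := HasMFDerivAt.prodMap (p := (show Y × rayOne from p)) (hasMFDerivAt_id (I := 𝓡 n) p.1)
    (hasMFDerivAt_rayTranslate τ hτ p.2)
  rw [(hasMFDerivAt_id (I := 𝓡 n) _).mfderiv, (hasMFDerivAt_rayTranslate τ hτ _).mfderiv] at h1
  exact congrArg (fun A : EuclideanSpace ℝ (Fin n) × ℝ →L[ℝ] EuclideanSpace ℝ (Fin n) × ℝ => A v)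
    h1.mfderiv

theorem enorm_mfderiv_cylTranslate (τ : ℝ) (hτ : 0 ≤ τ) (p : CylindricalEnd h)
    (v : TangentSpace ((𝓡 n).prod 𝓘(ℝ, ℝ)) p) :
    ‖mfderiv ((𝓡 n).prod 𝓘(ℝ, ℝ)) ((𝓡 n).prod 𝓘(ℝ, ℝ)) (cylTranslate (h := h) τ hτ) p v‖ₑ =
      ‖v‖ₑ := by
  rw [enorm_eq_iff_norm_eq, norm_eq_sqrt_real_inner, norm_eq_sqrt_real_inner]
  congr 1
  have key : ∀ w : EuclideanSpace ℝ (Fin n) × ℝ, w = v →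
      addSqForm (F := EuclideanSpace ℝ (Fin n)) (h.inner p.1) w w =
        addSqForm (F := EuclideanSpace ℝ (Fin n)) (h.inner p.1) v v := by
    rintro _ rfl
    rfl
  exact key _ (mfderiv_cylTranslate τ hτ p v)

theorem riemannianEDist_cylTranslate_le (τ : ℝ) (hτ : 0 ≤ τ) (p q : CylindricalEnd h) :
    riemannianEDist ((𝓡 n).prod 𝓘(ℝ, ℝ)) (cylTranslate τ hτ p) (cylTranslate τ hτ q) ≤
      riemannianEDist ((𝓡 n).prod 𝓘(ℝ, ℝ)) p q := by
  refine le_of_forall_gt fun r hr => ?_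
  obtain ⟨γ, hγ0, hγ1, hγ, hlen⟩ := exists_lt_of_riemannianEDist_lt hr
  refine lt_of_le_of_lt ?_ hlen
  have hT := contMDiff_cylTranslate (h := h) τ hτ
  refine (riemannianEDist_le_pathELength (γ := cylTranslate τ hτ ∘ γ)
    ((hT.of_le (by simp)).comp_contMDiffOn hγ) (by rw [Function.comp_apply, hγ0])
    (by rw [Function.comp_apply, hγ1]) zero_le_one).trans (le_of_eq ?_)
  rw [pathELength_eq_lintegral_mfderiv_Ioo, pathELength_eq_lintegral_mfderiv_Ioo]
  refine MeasureTheory.setLIntegral_congr_fun measurableSet_Ioo fun t ht => ?_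
  have hd : MDifferentiableAt 𝓘(ℝ, ℝ) ((𝓡 n).prod 𝓘(ℝ, ℝ)) γ t :=
    (hγ.contMDiffAt (Icc_mem_nhds ht.1 ht.2)).mdifferentiableAt one_ne_zero
  have hc := mfderiv_comp t (hT.mdifferentiable (by simp) (γ t)) hd
  rw [hc]
  exact enorm_mfderiv_cylTranslate τ hτ (γ t) _

/-- The coordinate along the cylinder. -/
def cylCoord (p : CylindricalEnd h) : ℝ := (p.2 : ℝ)

theorem contMDiff_cylCoord :
    ContMDiff ((𝓡 n).prod 𝓘(ℝ, ℝ)) 𝓘(ℝ, ℝ) ∞ (cylCoord (h := h)) :=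
  (contMDiff_subtype_val (I := 𝓘(ℝ, ℝ)) (U := rayOne)).comp
    (contMDiff_snd (I := 𝓡 n) (J := 𝓘(ℝ, ℝ)) (M := Y) (N := rayOne))

theorem mfderiv_cylCoord (p : CylindricalEnd h) (v : EuclideanSpace ℝ (Fin n) × ℝ) :
    (show ℝ from mfderiv ((𝓡 n).prod 𝓘(ℝ, ℝ)) 𝓘(ℝ, ℝ) (cylCoord (h := h)) p v) = v.2 := by
  have h1 := HasMFDerivAt.comp (show Y × rayOne from p) (hasMFDerivAt_val_rayOne p.2)
    (hasMFDerivAt_snd (I := 𝓡 n) (I' := 𝓘(ℝ, ℝ)) (show Y × rayOne from p))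
  exact congrArg (fun A : EuclideanSpace ℝ (Fin n) × ℝ →L[ℝ] ℝ => A v) h1.mfderiv

theorem enorm_mfderiv_cylCoord_le (p : CylindricalEnd h)
    (v : TangentSpace ((𝓡 n).prod 𝓘(ℝ, ℝ)) p) :
    ‖(show ℝ from mfderiv ((𝓡 n).prod 𝓘(ℝ, ℝ)) 𝓘(ℝ, ℝ) (cylCoord (h := h)) p v)‖ₑ ≤ ‖v‖ₑ := by
  rw [mfderiv_cylCoord p v, enorm_le_iff_norm_le, Real.norm_eq_abs]
  refine le_trans ?_ (le_of_eq (norm_eq_sqrt_real_inner v).symm)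
  apply Real.abs_le_sqrt
  have h1 : (inner ℝ v v : ℝ) = addSqForm (F := EuclideanSpace ℝ (Fin n)) (h.inner p.1) v v := rfl
  have h2 : 0 ≤ (show EuclideanSpace ℝ (Fin n) →L[ℝ] EuclideanSpace ℝ (Fin n) →L[ℝ] ℝ from
      h.inner p.1) (show EuclideanSpace ℝ (Fin n) × ℝ from v).1
      (show EuclideanSpace ℝ (Fin n) × ℝ from v).1 := by
    by_cases hv : (show EuclideanSpace ℝ (Fin n) × ℝ from v).1 = 0
    · rw [hv, map_zero]
    · exact (h.pos p.1 _ hv).le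
  rw [h1]
  refine le_trans ?_ (le_of_eq (addSqForm_apply (F := EuclideanSpace ℝ (Fin n)) _ _ _).symm)
  rw [sq]
  exact le_add_of_nonneg_left h2

theorem dist_cylCoord_lt_of_riemannianEDist_lt {p q : CylindricalEnd h} {ρ : ℝ}
    (hpq : riemannianEDist ((𝓡 n).prod 𝓘(ℝ, ℝ)) p q < ENNReal.ofReal ρ) :
    |cylCoord q - cylCoord p| < ρ := by
  obtain ⟨γ, hγ0, hγ1, hγ, hlen⟩ := exists_lt_of_riemannianEDist_lt hpq
  have hC := contMDiff_cylCoord (h := h)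
  have hf : ContDiffOn ℝ 1 (cylCoord ∘ γ) (Set.Icc 0 1) :=
    ((hC.of_le (by simp)).comp_contMDiffOn hγ).contDiffOn
  have h1 := enorm_sub_le_lintegral_deriv_of_contDiffOn_Icc hf zero_le_one
  have h2 : ∫⁻ t in Set.Icc (0 : ℝ) 1, ‖deriv (cylCoord ∘ γ) t‖ₑ ≤
      pathELength ((𝓡 n).prod 𝓘(ℝ, ℝ)) γ 0 1 := by
    rw [pathELength_eq_lintegral_mfderiv_Ioo, ← MeasureTheory.restrict_Ioo_eq_restrict_Icc]
    refine MeasureTheory.setLIntegral_mono' measurableSet_Ioo fun t ht => ?_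
    have hd : MDifferentiableAt 𝓘(ℝ, ℝ) ((𝓡 n).prod 𝓘(ℝ, ℝ)) γ t :=
      (hγ.contMDiffAt (Icc_mem_nhds ht.1 ht.2)).mdifferentiableAt one_ne_zero
    have hc := mfderiv_comp t (hC.mdifferentiable (by simp) (γ t)) hd
    rw [← fderiv_apply_one_eq_deriv, ← mfderiv_eq_fderiv, hc]
    exact enorm_mfderiv_cylCoord_le (γ t) _
  have h3 := (h1.trans h2).trans_lt hlen
  rw [Function.comp_apply, Function.comp_apply, hγ0, hγ1, Real.enorm_eq_ofReal_abs,
    ENNReal.ofReal_lt_ofReal_iff_of_nonneg (abs_nonneg _)] at h3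
  exact h3

theorem exists_isPreconnected_of_riemannianEDist_lt {p q : CylindricalEnd h} {ρ : ℝ≥0∞}
    (hpq : riemannianEDist ((𝓡 n).prod 𝓘(ℝ, ℝ)) p q < ρ) :
    ∃ Z : Set Y, IsPreconnected Z ∧ p.1 ∈ Z ∧ q.1 ∈ Z := by
  obtain ⟨γ, hγ0, hγ1, hγ, -⟩ := exists_lt_of_riemannianEDist_lt hpq
  have hfst : Continuous fun p : CylindricalEnd h => p.1 := continuous_fst (X := Y) (Y := rayOne)
  refine ⟨(fun t => (γ t).1) '' Set.Icc 0 1,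
    isPreconnected_Icc.image _ (hfst.comp_continuousOn hγ.continuousOn),
    ⟨0, by simp, congrArg (fun z : CylindricalEnd h => z.1) hγ0⟩,
    ⟨1, by simp, congrArg (fun z : CylindricalEnd h => z.1) hγ1⟩⟩

end CylinderDistance

section Assembly

theorem exists_contMDiff_finite_critical_bounded {E : Type*} [NormedAddCommGroup E]
    [NormedSpace ℝ E] [FiniteDimensional ℝ E] {H : Type*} [TopologicalSpace H]
    (I : ModelWithCorners ℝ E H) [I.Boundaryless] {Y : Type*} [TopologicalSpace Y]
    [ChartedSpace H Y] [IsManifold I ∞ Y] [T2Space Y] [CompactSpace Y] {ε : ℝ} (hε : 0 < ε) :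
    ∃ b : Y → ℝ, ContMDiff I 𝓘(ℝ, ℝ) ∞ b ∧ (∀ y, |b y| ≤ ε) ∧
      {y | mfderiv I 𝓘(ℝ, ℝ) b y = 0}.Finite := by
  obtain ⟨m, hm, hfin⟩ := exists_contMDiff_finite_critical I (Y := Y)
  obtain ⟨C, hC⟩ := isCompact_univ.exists_bound_of_continuousOn hm.continuous.continuousOn
  set κ : ℝ := ε / (|C| + 1) with hκ
  have hκ0 : 0 < κ := by positivity
  refine ⟨κ • m, (contMDiff_const (c := κ)).mul hm, fun y => ?_, hfin.subset fun y hy => ?_⟩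
  · have h1 : |m y| ≤ |C| + 1 := ((hC y (Set.mem_univ y)).trans (le_abs_self C)).trans (by simp)
    rw [Pi.smul_apply, smul_eq_mul, abs_mul, abs_of_pos hκ0]
    calc κ * |m y| ≤ κ * (|C| + 1) := by gcongr
      _ = ε := div_mul_cancel₀ _ (by positivity)
  · have h1 := (hm.mdifferentiable (by simp) y).hasMFDerivAt.const_smul κ
    have h2 : κ • mfderiv I 𝓘(ℝ, ℝ) m y = 0 := h1.mfderiv.symm.trans hy
    exact (smul_eq_zero.1 h2).resolve_left hκ0.ne'

theorem deriv_eq_zero_and_mfderiv_eq_zero_of_critical {E : Type*} [NormedAddCommGroup E]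
    [NormedSpace ℝ E] {H : Type*} [TopologicalSpace H] {I : ModelWithCorners ℝ E H} {Y : Type*}
    [TopologicalSpace Y] [ChartedSpace H Y] {a : ℝ → ℝ} {b : Y → ℝ} (ha : ContDiff ℝ ∞ a)
    (hb : ContMDiff I 𝓘(ℝ, ℝ) ∞ b) {z : Y × ℝ}
    (hz : mfderiv (I.prod 𝓘(ℝ, ℝ)) 𝓘(ℝ, ℝ) (fun z : Y × ℝ => a z.2 + b z.1) z = 0) :
    deriv a z.2 = 0 ∧ mfderiv I 𝓘(ℝ, ℝ) b z.1 = 0 := by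
  have hf : ContMDiff (I.prod 𝓘(ℝ, ℝ)) 𝓘(ℝ, ℝ) ∞ (fun z : Y × ℝ => a z.2 + b z.1) :=
    (ha.contMDiff.comp contMDiff_snd).add (hb.comp contMDiff_fst)
  have hfz := hf.mdifferentiable (by simp) z
  obtain ⟨y, r⟩ := z
  constructor
  · have h1 : MDifferentiableAt 𝓘(ℝ, ℝ) (I.prod 𝓘(ℝ, ℝ)) (fun r : ℝ => (y, r)) r :=
      (contMDiff_const.prodMk contMDiff_id).mdifferentiable (n := ∞) (by simp) r
    have h2 := mfderiv_comp r hfz h1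
    rw [hz] at h2
    have h3 : deriv (fun r => a r + b y) r = 0 := by
      rw [← fderiv_apply_one_eq_deriv, ← mfderiv_eq_fderiv]
      exact congrArg (fun A : ℝ →L[ℝ] ℝ => A 1) (h2.trans (ContinuousLinearMap.zero_comp _))
    rwa [deriv_add_const] at h3
  · have h1 : MDifferentiableAt I (I.prod 𝓘(ℝ, ℝ)) (fun y : Y => (y, r)) y :=
      (contMDiff_id.prodMk contMDiff_const).mdifferentiable (n := ∞) (by simp) y
    have h2 := mfderiv_comp y hfz h1
    rw [hz] at h2
    have h3 := (hasMFDerivAt_const (I := I) (I' := 𝓘(ℝ, ℝ)) (a r) y).add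
      (hb.mdifferentiable (by simp) y).hasMFDerivAt
    have h4 := h3.mfderiv
    have h5 : mfderiv I 𝓘(ℝ, ℝ) b y = mfderiv I 𝓘(ℝ, ℝ) ((fun _ => a r) + b) y :=
      (h4.trans (zero_add (show E →L[ℝ] ℝ from mfderiv I 𝓘(ℝ, ℝ) b y))).symm
    exact h5.trans (h2.trans (ContinuousLinearMap.zero_comp _))

theorem IsInjImmersion.mfderiv_eq_zero_of_comp {E : Type*} [NormedAddCommGroup E] [NormedSpace ℝ E]
    [FiniteDimensional ℝ E] {H : Type*} [TopologicalSpace H] {I : ModelWithCorners ℝ E H}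
    {X : Type*} [TopologicalSpace X] [ChartedSpace H X] {Ψ : X → X} (hΨ : IsInjImmersion I Ψ)
    {f : X → ℝ} (hf : ContMDiff I 𝓘(ℝ, ℝ) ∞ f) {x : X}
    (hx : mfderiv I 𝓘(ℝ, ℝ) (f ∘ Ψ) x = 0) : mfderiv I 𝓘(ℝ, ℝ) f (Ψ x) = 0 := by
  rw [mfderiv_comp x (hf.mdifferentiable (by simp) _) (hΨ.contMDiff.mdifferentiable (by simp) x)]
    at hx
  have hsurj : Function.Surjective (mfderiv I I Ψ x) :=
    LinearMap.injective_iff_surjective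
      (f := (show E →L[ℝ] E from mfderiv I I Ψ x).toLinearMap).1 (hΨ.injective_mfderiv x)
  refine ContinuousLinearMap.ext fun v => ?_
  obtain ⟨w, rfl⟩ := hsurj v
  exact congrArg (fun A : E →L[ℝ] ℝ => A w) hx

/-- The longitudinal profile, of period `4 R`. -/
noncomputable def profile (R r : ℝ) : ℝ := 2 + 1 / 2 * Real.sin (Real.pi * (r - 1) / (2 * R))

theorem contDiff_profile (R : ℝ) : ContDiff ℝ ∞ (profile R) := by
  unfold profile
  fun_prop

theorem profile_sub_nat_mul {R : ℝ} (hR : 0 < R) (r : ℝ) (k : ℕ) :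
    profile R (r - k * (4 * R)) = profile R r := by
  have : Real.pi * (r - k * (4 * R) - 1) / (2 * R) =
      Real.pi * (r - 1) / (2 * R) - k * (2 * Real.pi) := by
    field_simp
    ring
  rw [profile, this, Real.sin_sub_nat_mul_two_pi, profile]

theorem profile_mem_Icc (R r : ℝ) : profile R r ∈ Set.Icc (3 / 2) (5 / 2) := by
  have h1 := Real.neg_one_le_sin (Real.pi * (r - 1) / (2 * R))
  have h2 := Real.sin_le_one (Real.pi * (r - 1) / (2 * R))
  constructor <;> unfold profile <;> linarith

theorem eq_or_eq_of_deriv_profile_eq_zero {R r : ℝ} (hR : 0 < R)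
    (hr : r ∈ Set.Icc 1 (1 + 4 * R)) (h0 : deriv (profile R) r = 0) :
    r = 1 + R ∨ r = 1 + 3 * R := by
  have hpi := Real.pi_pos
  have hd : HasDerivAt (profile R)
      (1 / 2 * (Real.cos (Real.pi * (r - 1) / (2 * R)) * (Real.pi * 1 / (2 * R)))) r :=
    ((((((hasDerivAt_id r).sub_const 1).const_mul Real.pi).div_const (2 * R)).sin).const_mul
      (1 / 2)).const_add 2
  rw [hd.deriv] at h0
  have hcos : Real.cos (Real.pi * (r - 1) / (2 * R)) = 0 := by
    have hne : Real.pi * 1 / (2 * R) ≠ 0 := by positivity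
    simpa [hne, hpi.ne', hR.ne'] using h0
  obtain ⟨k, hk⟩ := Real.cos_eq_zero_iff.1 hcos
  have hrk : r - 1 = (2 * k + 1) * R := by
    field_simp at hk
    linarith
  have h1 : (0 : ℝ) ≤ (2 * k + 1) * R := by linarith [hr.1]
  have h2 : (2 * k + 1 : ℝ) * R ≤ 4 * R := by linarith [hr.2]
  have h3 : (0 : ℝ) ≤ 2 * k + 1 := nonneg_of_mul_nonneg_left h1 hR
  have h4 : (2 * k + 1 : ℝ) ≤ 4 := le_of_mul_le_mul_right h2 hR
  have h5 : (0 : ℤ) ≤ 2 * k + 1 := by exact_mod_cast h3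
  have h6 : 2 * k + 1 ≤ (4 : ℤ) := by exact_mod_cast h4
  obtain rfl | rfl : k = 0 ∨ k = 1 := by omega
  · left
    push_cast at hrk
    linarith
  · right
    push_cast at hrk
    linarith

variable {n : ℕ} {Y : Type*} [TopologicalSpace Y] [ChartedSpace (EuclideanSpace ℝ (Fin n)) Y]
  [IsManifold (𝓡 n) ∞ Y]
  (h : ContMDiffRiemannianMetric (𝓡 n) ∞ (EuclideanSpace ℝ (Fin n))
      (fun y : Y => TangentSpace (𝓡 n) y))

/-- A retraction of `ℝ` into the half-line. -/
noncomputable def toRay (r : ℝ) : rayOne :=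
  ⟨max r (3 / 2), show (1 : ℝ) < _ from lt_of_lt_of_le (by norm_num) (le_max_right _ _)⟩

theorem continuous_toRay : Continuous toRay :=
  Continuous.subtype_mk (continuous_id.max continuous_const) _

/-- A retraction of `Y × ℝ` into the cylindrical end. -/
noncomputable def toCyl (z : Y × ℝ) : CylindricalEnd h :=
  (z.1, toRay z.2)

theorem continuous_toCyl : Continuous (toCyl h) :=
  (continuous_fst.prodMk (continuous_toRay.comp continuous_snd) :
    Continuous fun z : Y × ℝ => ((z.1, toRay z.2) : Y × rayOne))

/-- A neighbourhood of `c` of small diameter for the distance of the cylindrical end. -/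
noncomputable def cylNhd (w : ℝ) (c : Y × ℝ) : Set (Y × ℝ) :=
  interior {z | 3 / 2 < z.2 ∧
    riemannianEDist ((𝓡 n).prod 𝓘(ℝ, ℝ)) (toCyl h c) (toCyl h z) < ENNReal.ofReal (w / 2)}

theorem mem_cylNhd_self {w : ℝ} (hw : 0 < w) {c : Y × ℝ} (hc : 3 / 2 < c.2) : c ∈ cylNhd h w c := by
  rw [cylNhd, mem_interior_iff_mem_nhds]
  have hM : IsManifold ((𝓡 n).prod 𝓘(ℝ, ℝ)) 1 (CylindricalEnd h) := .of_le (n := ∞) (by simp)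
  exact Filter.Eventually.and (continuousAt_snd.eventually (lt_mem_nhds hc))
    ((continuous_toCyl h).continuousAt.eventually
      (eventually_riemannianEDist_lt ((𝓡 n).prod 𝓘(ℝ, ℝ)) (toCyl h c) (by simpa using hw)))

theorem cylTranslate_toCyl {τ : ℝ} (hτ : 0 ≤ τ) (p : CylindricalEnd h)
    (hp : 3 / 2 < cylCoord p - τ) :
    cylTranslate τ hτ (toCyl h (p.1, cylCoord p - τ)) = p := by
  have h1 : rayTranslate τ hτ (toRay (cylCoord p - τ)) = p.2 := by
    refine Subtype.ext ?_
    change max (cylCoord p - τ) (3 / 2) + τ = cylCoord p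
    rw [max_eq_left hp.le, sub_add_cancel]
  exact congrArg (fun r : rayOne => ((p.1, r) : Y × rayOne)) h1

variable {h} in
theorem riemannianEDist_lt_of_mem_cylNhd {w τ : ℝ} (hw : 0 < w) (hτ : 0 ≤ τ) {c : Y × ℝ}
    {p q : CylindricalEnd h} (hp : (p.1, cylCoord p - τ) ∈ cylNhd h w c)
    (hq : (q.1, cylCoord q - τ) ∈ cylNhd h w c) :
    riemannianEDist ((𝓡 n).prod 𝓘(ℝ, ℝ)) p q < ENNReal.ofReal w := by
  obtain ⟨hp0, hp1⟩ := interior_subset hp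
  obtain ⟨hq0, hq1⟩ := interior_subset hq
  rw [← cylTranslate_toCyl h hτ p hp0, ← cylTranslate_toCyl h hτ q hq0]
  refine (riemannianEDist_cylTranslate_le τ hτ _ _).trans_lt
    ((riemannianEDist_triangle (y := toCyl h c)).trans_lt ?_)
  rw [riemannianEDist_comm]
  refine (ENNReal.add_lt_add hp1 hq1).trans_le ?_
  rw [← ENNReal.ofReal_add (by positivity) (by positivity), add_halves]

end Assembly

section Gluing

variable {Y : Type*} {ι : Type*}

/-- The slab of the cylinder containing the coordinate `r`. -/
noncomputable def slabIndex (R r : ℝ) : ℕ := ⌊(r - 1) / (4 * R)⌋₊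

theorem slabIndex_spec {R r : ℝ} (hR : 0 < R) (hr : 1 < r) :
    1 + slabIndex R r * (4 * R) ≤ r ∧ r < 1 + (slabIndex R r + 1) * (4 * R) := by
  have h1 : 0 ≤ (r - 1) / (4 * R) := div_nonneg (by linarith) (by linarith)
  have h2 := (le_div_iff₀ (by linarith)).1 (Nat.floor_le h1)
  have h3 := (div_lt_iff₀ (by linarith)).1 (Nat.lt_floor_add_one ((r - 1) / (4 * R)))
  rw [slabIndex]
  constructor <;> linarith

/-- Functions that agree with a periodic function near the ends of a slab glue. -/
theorem slab_gluing {g : ι → Y × ℝ → ℝ} {g₀ : Y × ℝ → ℝ} {R : ℝ} (hR : 0 < R)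
    (hg₀ : ∀ y r (k : ℕ), g₀ (y, r - k * (4 * R)) = g₀ (y, r))
    (hg : ∀ i y r, r ∉ Set.Ioo (1 + R / 2) (1 + 7 * R / 2) → g i (y, r) = g₀ (y, r))
    (D : ℕ → ι) {y : Y} {r : ℝ} (hr : 1 < r) {k : ℕ}
    (hk : r - k * (4 * R) ∈ Set.Ioo (1 - R / 2) (1 + 4 * R)) :
    g (D (slabIndex R r)) (y, r - slabIndex R r * (4 * R)) = g (D k) (y, r - k * (4 * R)) := by
  obtain ⟨h1, h2⟩ := slabIndex_spec hR hr
  set k' := slabIndex R r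
  rcases eq_or_ne k' k with heq | hne
  · rw [heq]
  have hlt : k' < k + 1 := by
    have : (k' : ℝ) * (4 * R) < (k + 1) * (4 * R) := by linarith [hk.2]
    exact_mod_cast lt_of_mul_lt_mul_right this (by linarith)
  have hle : (k' : ℝ) + 1 ≤ k := by
    have : k' + 1 ≤ k := by omega
    exact_mod_cast this
  have hmul : ((k' : ℝ) + 1) * (4 * R) ≤ k * (4 * R) := by gcongr
  rw [hg, hg, hg₀, hg₀]
  · rintro ⟨h3, -⟩
    linarith
  · rintro ⟨-, h3⟩
    linarith [hk.1]

end Gluing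

section Main

variable {n : ℕ} {Y : Type*} [TopologicalSpace Y]
    [ChartedSpace (EuclideanSpace ℝ (Fin n)) Y] [IsManifold (𝓡 n) ∞ Y]
    {h : ContMDiffRiemannianMetric (𝓡 n) ∞ (EuclideanSpace ℝ (Fin n))
      (fun y : Y => TangentSpace (𝓡 n) y)}

/-- Near any slice of the cylinder, there is a point of the network in a given component. -/
theorem exists_network_mem_component {a : CylindricalEnd h → ℝ} {L w κ : ℝ}
    {S : Set (CylindricalEnd h)} (hNCC : NetworkControl ((𝓡 n).prod 𝓘(ℝ, ℝ)) a L w κ S) {R : ℝ}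
    (hLR : L < R) (k : ℕ) {p : Y × ℝ} (hp : p.2 ∈ Set.Ioo (1 + R / 2) (1 + 7 * R / 2)) :
    ∃ s ∈ S, cylCoord s - k * (4 * R) ∈ Set.Icc (1 + R) (1 + 3 * R) ∧
      (s.1, cylCoord s - k * (4 * R)) ∈ connectedComponentIn
        ((Set.univ : Set Y) ×ˢ Set.Ioo (1 + R / 2) (1 + 7 * R / 2)) p := by
  have hL := hNCC.L_pos
  have hR : 0 < R := hL.trans hLR
  have hr : 1 < 1 + k * (4 * R) + 2 * R := by
    have : 0 ≤ k * (4 * R) := by positivity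
    linarith
  let x : CylindricalEnd h := (p.1, (⟨1 + k * (4 * R) + 2 * R, hr⟩ : rayOne))
  have h1 : (⨅ y ∈ S, riemannianEDist ((𝓡 n).prod 𝓘(ℝ, ℝ)) x y) < ENNReal.ofReal R :=
    (hNCC.dist_le x).trans_lt ((ENNReal.ofReal_lt_ofReal_iff hR).2 hLR)
  simp only [iInf_lt_iff] at h1
  obtain ⟨s, hs, hxs⟩ := h1
  have h2 := abs_lt.1 (dist_cylCoord_lt_of_riemannianEDist_lt hxs)
  have hx : cylCoord x = 1 + k * (4 * R) + 2 * R := rfl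
  rw [hx] at h2
  obtain ⟨Z, hZ, hxZ, hsZ⟩ := exists_isPreconnected_of_riemannianEDist_lt hxs
  refine ⟨s, hs, ⟨by linarith [h2.1], by linarith [h2.2]⟩, ?_⟩
  refine (hZ.prod isPreconnected_Ioo).subset_connectedComponentIn (x := p) ⟨hxZ, hp⟩
    (Set.prod_mono_left (Set.subset_univ Z)) ⟨hsZ, ?_, ?_⟩
  · change 1 + R / 2 < cylCoord s - k * (4 * R)
    linarith [h2.1]
  · change cylCoord s - k * (4 * R) < 1 + 7 * R / 2
    linarith [h2.2]

/-- A function in `C_b^∞` on the cylindrical end with gradient bounded below off the network. -/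
theorem exists_isCbInfty_le_norm_riemGradient [T2Space Y] [CompactSpace Y]
    (a : CylindricalEnd h → ℝ) (L w κ : ℝ) (S : Set (CylindricalEnd h)) (hNCC : NetworkControl ((𝓡 n).prod 𝓘(ℝ, ℝ)) a L w κ S) :
    ∃ ψ : CylindricalEnd h → ℝ, IsCbInfty ((𝓡 n).prod 𝓘(ℝ, ℝ)) ψ ∧
      (∀ x, 1 ≤ ψ x ∧ ψ x ≤ 3) ∧ ∃ ρ : ℝ, 0 < ρ ∧
        ∀ x, x ∉ (⋃ y ∈ S, riemBall ((𝓡 n).prod 𝓘(ℝ, ℝ)) y w) →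
          ρ ≤ ‖riemGradient ((𝓡 n).prod 𝓘(ℝ, ℝ)) ψ x‖ := by
  classical
  have hL := hNCC.L_pos
  have hw := hNCC.w_pos
  set R : ℝ := L + 1 with hRdef
  have hR1 : 1 < R := by linarith
  have hR : 0 < R := by linarith
  have : LocallyConnectedSpace (ModelProd (EuclideanSpace ℝ (Fin n)) ℝ) :=
    inferInstanceAs (LocallyConnectedSpace (EuclideanSpace ℝ (Fin n) × ℝ))
  have : LocallyConnectedSpace (Y × ℝ) :=
    ChartedSpace.locallyConnectedSpace (ModelProd (EuclideanSpace ℝ (Fin n)) ℝ) (Y × ℝ)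
  obtain ⟨b, hb, hb1, hbfin⟩ := exists_contMDiff_finite_critical_bounded (𝓡 n) (Y := Y)
    (show (0 : ℝ) < 1 / 2 by norm_num)
  let ψ₀ : Y × ℝ → ℝ := fun z => profile R z.2 + b z.1
  have hψ₀ : ContMDiff ((𝓡 n).prod 𝓘(ℝ, ℝ)) 𝓘(ℝ, ℝ) ∞ ψ₀ :=
    ((contDiff_profile R).contMDiff.comp contMDiff_snd).add (hb.comp contMDiff_fst)
  have hψ₀b : ∀ z, 1 ≤ ψ₀ z ∧ ψ₀ z ≤ 3 := fun z => by
    have h1 := profile_mem_Icc R z.2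
    have h2 := abs_le.1 (hb1 z.1)
    constructor <;> simp only [ψ₀] <;> linarith [h1.1, h1.2, h2.1, h2.2]
  let N : Set (Y × ℝ) := Set.univ ×ˢ Set.Ioo (1 + R / 2) (1 + 7 * R / 2)
  have hN : IsOpen N := isOpen_univ.prod isOpen_Ioo
  let F : Set (Y × ℝ) := {y | mfderiv (𝓡 n) 𝓘(ℝ, ℝ) b y = 0} ×ˢ {1 + R, 1 + 3 * R}
  have hF : F.Finite := hbfin.prod (Set.toFinite _)
  have hFN : F ⊆ N := by
    rintro ⟨y, r⟩ ⟨-, hr⟩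
    refine ⟨Set.mem_univ _, ?_⟩
    rcases hr with rfl | rfl <;> constructor <;> dsimp only <;> linarith
  have hFcrit : ∀ z : Y × ℝ, z.2 ∈ Set.Icc 1 (1 + 4 * R) →
      mfderiv ((𝓡 n).prod 𝓘(ℝ, ℝ)) 𝓘(ℝ, ℝ) ψ₀ z = 0 → z ∈ F := by
    intro z hz h0
    obtain ⟨h1, h2⟩ := deriv_eq_zero_and_mfderiv_eq_zero_of_critical (contDiff_profile R) hb h0
    exact ⟨h2, eq_or_eq_of_deriv_profile_eq_zero hR hz h1⟩
  obtain ⟨C, hCK, hC⟩ := (isCompact_univ.prod isCompact_Icc :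
    IsCompact ((Set.univ : Set Y) ×ˢ Set.Icc (1 + R) (1 + 3 * R))).elim_nhds_subcover
    (cylNhd h w) (fun c hc => isOpen_interior.mem_nhds
      (mem_cylNhd_self h hw (lt_of_lt_of_le (by linarith) hc.2.1)))
  let U : Finset (Y × ℝ) → Set (Y × ℝ) := fun D => ⋃ c ∈ D, cylNhd h w c
  have hU : ∀ D, IsOpen (U D) := fun D => isOpen_biUnion fun c _ => isOpen_interior
  let ι := {D : Finset (Y × ℝ) // D ∈ C.powerset ∧
    ∀ p ∈ F, (connectedComponentIn N p ∩ U D).Nonempty}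
  have hι : Finite ι := Finite.of_injective (β := C.powerset) (fun D => ⟨D.1, D.2.1⟩)
    fun D D' hD => Subtype.ext (congrArg (fun E : C.powerset => E.1) hD)
  have hmove : ∀ D : ι, ∃ Ψ : Y × ℝ → Y × ℝ, IsInjImmersion ((𝓡 n).prod 𝓘(ℝ, ℝ)) Ψ ∧
      (∀ z ∉ N, Ψ z = z) ∧ ∀ z, Ψ z ∈ F → z ∈ U D.1 := fun D =>
    exists_injImmersion_of_finite hF hN (hU D.1) hFN D.2.2
  choose Ψ hΨ hΨN hΨU using hmove
  let f : ι → Y × ℝ → ℝ := fun D => ψ₀ ∘ Ψ D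
  have hf : ∀ D, ContMDiff ((𝓡 n).prod 𝓘(ℝ, ℝ)) 𝓘(ℝ, ℝ) ∞ (f D) := fun D =>
    hψ₀.comp (hΨ D).contMDiff
  have hcrit : ∀ D, ∀ z : Y × ℝ, z.2 ∈ Set.Icc 1 (1 + 4 * R) →
      mfderiv ((𝓡 n).prod 𝓘(ℝ, ℝ)) 𝓘(ℝ, ℝ) (f D) z = 0 → z ∈ U D.1 := by
    intro D z hz h0
    refine hΨU D z (hFcrit _ ?_ ((hΨ D).mfderiv_eq_zero_of_comp hψ₀ h0))
    by_cases hzN : z ∈ N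
    · have := ((hΨ D).injective.mapsTo_of_eq_off (hΨN D) hzN).2
      exact ⟨by linarith [this.1], by linarith [this.2]⟩
    · rwa [hΨN D z hzN]
  let D₀ : ℕ → Finset (Y × ℝ) := fun k =>
    {c ∈ C | ∃ s ∈ S, (s.1, cylCoord s - k * (4 * R)) ∈ cylNhd h w c}
  have hD₀ : ∀ k, D₀ k ∈ C.powerset ∧ ∀ p ∈ F, (connectedComponentIn N p ∩ U (D₀ k)).Nonempty := by
    intro k
    refine ⟨Finset.mem_powerset.2 (Finset.filter_subset _ _), fun p hp => ?_⟩
    obtain ⟨s, hs, hsI, hsc⟩ := exists_network_mem_component hNCC (by linarith) k (hFN hp).2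
    have hmem := hC (show ((s.1, cylCoord s - k * (4 * R)) : Y × ℝ) ∈ _ from ⟨Set.mem_univ _, hsI⟩)
    simp only [Set.mem_iUnion] at hmem
    obtain ⟨c, hcC, hc⟩ := hmem
    exact ⟨_, hsc, Set.mem_biUnion (Finset.mem_filter.2 ⟨hcC, s, hs, hc⟩) hc⟩
  let D : ℕ → ι := fun k => ⟨D₀ k, hD₀ k⟩
  let ψ : CylindricalEnd h → ℝ := fun q =>
    f (D (slabIndex R (cylCoord q))) (q.1, cylCoord q - slabIndex R (cylCoord q) * (4 * R))
  have hr : ∀ q : CylindricalEnd h, 1 < cylCoord q := fun q => q.2.2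
  have hcont : Continuous (cylCoord (h := h)) := contMDiff_cylCoord.continuous
  have hslab : ∀ p : CylindricalEnd h,
      cylCoord p - slabIndex R (cylCoord p) * (4 * R) ∈ Set.Icc 1 (1 + 4 * R) := fun p => by
    obtain ⟨h1, h2⟩ := slabIndex_spec hR (hr p)
    constructor <;> linarith
  have hloc : ∀ p : CylindricalEnd h, ∀ᶠ q in 𝓝 p, ψ q = f (D (slabIndex R (cylCoord p)))
      (q.1, (q.2 : ℝ) - slabIndex R (cylCoord p) * (4 * R)) := by
    intro p
    obtain ⟨h1, h2⟩ := slabIndex_spec hR (hr p)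
    have h3 : cylCoord p - slabIndex R (cylCoord p) * (4 * R) ∈
        Set.Ioo (1 - R / 2) (1 + 4 * R) := ⟨by linarith, by linarith⟩
    filter_upwards [(hcont.sub continuous_const).continuousAt.preimage_mem_nhds
      (isOpen_Ioo.mem_nhds h3)] with q hq
    refine slab_gluing hR (g := f) (g₀ := ψ₀) ?_ ?_ D (hr q) hq
    · intro y r k
      simp only [ψ₀, profile_sub_nat_mul hR]
    · intro i y r hyr
      simp only [f, Function.comp_apply]
      rw [hΨN i (y, r) fun hn => hyr hn.2]
  obtain ⟨ρ, hρ, hgrad⟩ := exists_le_norm_riemGradient (h := h) hf (U := fun D => U D.1)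
    (fun D => hU D.1) hcrit
  have hCb : IsCbInfty ((𝓡 n).prod 𝓘(ℝ, ℝ)) ψ :=
    isCbInfty_of_eventually_eq_translate hf fun p => ⟨_, _, hslab p, hloc p⟩
  refine ⟨ψ, hCb, fun x => hψ₀b _, ρ, hρ, fun p hp => ?_⟩
  refine hgrad ψ p (D (slabIndex R (cylCoord p))) _ hCb.1 (hslab p) (fun hmem => hp ?_) (hloc p)
  simp only [U, Set.mem_iUnion] at hmem
  obtain ⟨c, hcD, hpc⟩ := hmem
  obtain ⟨-, s, hs, hsc⟩ := Finset.mem_filter.1 hcD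
  exact Set.mem_biUnion hs (riemannianEDist_lt_of_mem_cylNhd hw (by positivity) hsc hpc)

end Main

theorem lemma3p1 {n : ℕ} {Y : Type*} [TopologicalSpace Y] [T2Space Y] [CompactSpace Y]
    [ChartedSpace (EuclideanSpace ℝ (Fin n)) Y] [IsManifold (𝓡 n) ∞ Y]
    (h : ContMDiffRiemannianMetric (𝓡 n) ∞ (EuclideanSpace ℝ (Fin n))
      (fun y : Y => TangentSpace (𝓡 n) y))
    (a : CylindricalEnd h → ℝ) (L w β : ℝ) (S : Set (CylindricalEnd h))
    (hNCC : NetworkControl ((𝓡 n).prod 𝓘(ℝ, ℝ)) a L w (2 * β) S) :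
    ∃ ψ : CylindricalEnd h → ℝ,
      IsCbInfty ((𝓡 n).prod 𝓘(ℝ, ℝ)) ψ ∧
      (∀ x, 1 ≤ ψ x ∧ ψ x ≤ 3) ∧
      ∃ ρ : ℝ, 0 < ρ ∧
        (∀ x, a x < 2 * β → 2 * ρ ≤ ‖riemGradient ((𝓡 n).prod 𝓘(ℝ, ℝ)) ψ x‖) ∧
        ((⋃ y ∈ S, riemBall ((𝓡 n).prod 𝓘(ℝ, ℝ)) y w) ⊆ superlevel a (2 * β) →
          ∀ x, x ∉ superlevel a (2 * β) →
            2 * ρ ≤ ‖riemGradient ((𝓡 n).prod 𝓘(ℝ, ℝ)) ψ x‖) := by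
  obtain ⟨ψ, hψ, hb, ρ, hρ, hgrad⟩ := exists_isCbInfty_le_norm_riemGradient a L w (2 * β) S hNCC
  refine ⟨ψ, hψ, hb, ρ / 2, by positivity, fun x hx => ?_, fun hsub x hx => ?_⟩
  · rw [mul_div_cancel₀ ρ two_ne_zero]
    exact hgrad x fun hmem => hx.not_ge (hNCC.le_on_balls x hmem)
  · rw [mul_div_cancel₀ ρ two_ne_zero]
    exact hgrad x fun hmem => hx (hsub hmem)
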